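/- Let $d\ge 1$ and let $\mathbb S^d\subset\mathbb R^{d+1}$ be the unit sphere, with normalized surface measure $\sigma$ and geodesic distance $d(x,y)=\arccos\langle x,y\rangle$. For $f\in L^1(\mathbb S^d)$ (real-valued) put $$[f]_{BV}=\sup\Big\{\int_{\mathbb S^d} f\,\operatorname{div}\phi\,d\sigma:\ \phi \text{ a smooth tangent vector field on }\mathbb S^d,\ |\phi|\le 1\Big\},$$ and let $BV(\mathbb S^d)$ be the set of $f\in L^1(\mathbb S^d)$ with $[f]_{BV}<\infty$. Let $(\varrho_L)_{L\ge 0}$ be a family of radial mollifiers on $\mathbb S^d$, that is, of measurable functions $\varrho_L:(0,\infty)\to[0,\infty)$ such that, for all $y\in\mathbb S^d$, $$\text{(i)}\ \int_{\mathbb S^d}\varrho_L(d(x,y))\,d\sigma(x)=1\ \text{ for all } L,\qquad \text{(ii)}\ \lim_{L\to\infty}\int_{\{x:\,d(x,y)\ge\delta\}}\varrho_L(d(x,y))\,d\sigma(x)=0\ \text{ for all }\delta>0 .$$ (The $\varrho_L$ need not be monotone. The index $L$ may be real or integer; more generally, it may range over any index set, with $L\to\infty$ meaning convergence along a fixed filter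 on that set.) Then, for every $f\in BV(\mathbb S^d)$, the double integral below is finite for every $L$, and $$\lim_{L\to\infty}\iint_{\mathbb S^d\times\mathbb S^d}\frac{|f(x)-f(y)|}{d(x,y)}\,\varrho_L(d(x,y))\,d\sigma(x)\,d\sigma(y)=K_d\,[f]_{BV},$$ where $K_d=\int_{\mathbb S^{d-1}}|\langle e,\xi\rangle|\,d\sigma(\xi)$ for any $e\in\mathbb S^{d-1}$, $\sigma$ here being the normalized surface measure of $\mathbb S^{d-1}$. -/

import Mathlib

open MeasureTheory Set Filter Topology Metric
open scoped ContDiff RealInnerProductSpace ENNReal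

noncomputable section

/-- The unit sphere of the Euclidean space `ℝⁿ`; thus `𝕊ᵈ` is `USphere (d + 1)`. -/
abbrev USphere (n : ℕ) : Type := sphere (0 : EuclideanSpace ℝ (Fin n)) 1

/-- The normalized surface measure on the unit sphere of `ℝⁿ`
(for `n = 1`, mass `1/2` at each of the two points). -/
def sphereσ (n : ℕ) : Measure (USphere n) :=
  ((volume : Measure (EuclideanSpace ℝ (Fin n))).toSphere univ)⁻¹ •
    (volume : Measure (EuclideanSpace ℝ (Fin n))).toSphere

/-- The geodesic distance `arccos ⟨x, y⟩` on the unit sphere. -/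
def geoDist {n : ℕ} (x y : USphere n) : ℝ :=
  Real.arccos ⟪(x : EuclideanSpace ℝ (Fin n)), (y : EuclideanSpace ℝ (Fin n))⟫

/-- The divergence on the unit sphere, at the point `x`, of a tangent vector field given as the
restriction of a smooth map `X : ℝⁿ → ℝⁿ`: the trace over the tangent space `x^⊥` of the bilinear
form `(v, w) ↦ ⟨DX(x) v, w⟩`, that is, the full trace minus the contribution of the unit normal `x`.
It depends only on the restriction of `X` to the sphere. -/
def sphereDiv {n : ℕ} (X : EuclideanSpace ℝ (Fin n) → EuclideanSpace ℝ (Fin n))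
    (x : USphere n) : ℝ :=
  LinearMap.trace ℝ (EuclideanSpace ℝ (Fin n))
      (fderiv ℝ X x : EuclideanSpace ℝ (Fin n) →ₗ[ℝ] EuclideanSpace ℝ (Fin n)) -
    ⟪fderiv ℝ X x (x : EuclideanSpace ℝ (Fin n)), (x : EuclideanSpace ℝ (Fin n))⟫

/-- Test fields: smooth tangent vector fields on the unit sphere (identified with one-forms through
the metric) of pointwise norm at most one, as restrictions of smooth maps of the ambient space. -/
structure IsTestField {n : ℕ} (X : EuclideanSpace ℝ (Fin n) → EuclideanSpace ℝ (Fin n)) :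
    Prop where
  smooth : ContDiff ℝ ∞ X
  tangent : ∀ x : USphere n, ⟪X x, (x : EuclideanSpace ℝ (Fin n))⟫ = 0
  norm_le_one : ∀ x : USphere n, ‖X x‖ ≤ 1

/-- The total variation `[f]_BV = |Df|`, the supremum of `∫ f div X dσ` over the test fields `X`.
The supremum is nonnegative, as `X` can be replaced by `-X`. -/
def totalVariation {n : ℕ} (f : USphere n → ℝ) : ℝ≥0∞ :=
  ⨆ (X : EuclideanSpace ℝ (Fin n) → EuclideanSpace ℝ (Fin n)) (_ : IsTestField X),
    ENNReal.ofReal (∫ x, f x * sphereDiv X x ∂(sphereσ n))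

/-- Functions of bounded variation on the unit sphere. -/
structure IsBV {n : ℕ} (f : USphere n → ℝ) : Prop where
  integrable : Integrable f (sphereσ n)
  finite_variation : totalVariation f < ⊤

/-- A family of radial mollifiers `ρ L : (0, ∞) → [0, ∞)` on the unit sphere of `ℝⁿ`, with mass
concentrating at the diagonal as `L` tends to infinity, the latter being expressed by a filter `l`
on the set of indices (values of `ρ L` outside `(0, ∞)` play no role). -/
structure IsRadialMollifier (n : ℕ) {ι : Type*} (l : Filter ι) (ρ : ι → ℝ → ℝ) : Prop where
  measurable : ∀ L, Measurable (fun r : Ioi (0 : ℝ) => ρ L r)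
  nonneg : ∀ L, ∀ r, 0 < r → 0 ≤ ρ L r
  mass_one : ∀ L, ∀ y : USphere n, ∫ x, ρ L (geoDist x y) ∂(sphereσ n) = 1
  concentrate : ∀ y : USphere n, ∀ δ : ℝ, 0 < δ →
    Tendsto (fun L => ∫ x in {x : USphere n | geoDist x y < δ}ᶜ, ρ L (geoDist x y) ∂(sphereσ n))
      l (𝓝 0)

/-- The constant `K_d = ∫_{𝕊^{d-1}} |⟨e, ξ⟩| dσ(ξ)`, for a point `e` of `𝕊^{d-1}`. -/
def davilaConst {d : ℕ} (e : USphere d) : ℝ :=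
  ∫ ξ : USphere d, |⟪(e : EuclideanSpace ℝ (Fin d)), (ξ : EuclideanSpace ℝ (Fin d))⟫| ∂(sphereσ d)

end

noncomputable section

/-! ### The orthogonal group and its action on the sphere -/

/-! Everything is reduced to one function of an angle. Averaging `|f (g x) - f (g y)|` over the
orthogonal group gives `avgDiff f x y`, which depends only on the geodesic distance; write it `A θ`.
The double integral equals the integral of `A θ / θ` against the mollifier, `θ` being the distance
to a fixed point (`integral_radial_eq`). As the mollifier is a probability density concentrating at
`θ = 0`, it suffices that `A θ / θ` tends to `K_d [f]_BV` and never exceeds it; no monotonicity of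
the mollifier is needed.

By the triangle inequality `A` is subadditive along a great circle (`avgDiff_arc_add`), so the limit
of `A θ / θ` at `0` is its supremum, and the task is to show that this supremum is `K_d [f]_BV`.
Both inequalities pass through the smooth functions `moll f k`, averages of `f` against `(1 + ⟪x,
z⟫) ^ (k + 2)`, for which differentiation gives the limit `K_d ∫ |∇ moll f k|`
(`tendsto_avgDiff_moll`).

Upper bound (`avgDiff_arc_le`): by duality with a transport of tangent fields, mollification does
not increase the variation (`integral_norm_mollGrad_le`); `L¹` convergence then carries the bound
over to `f`. Lower bound (`davilaConst_mul_variation_le`): a bound `A t ≤ S t` passes to the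
mollifications, since these are averages over rotations (`avgDiff_moll_le_of_le`); hence `K_d ∫ |∇
moll f k| ≤ S`, and the divergence theorem with lower semicontinuity gives `K_d [f]_BV ≤ S`. -/

abbrev Eu (n : ℕ) : Type := EuclideanSpace ℝ (Fin n)

/-- The orthogonal group of `ℝⁿ`, as a compact topological group. -/
abbrev OGroup (n : ℕ) : Type := unitary (Eu n →L[ℝ] Eu n)

instance continuousStar_clm (n : ℕ) : ContinuousStar (Eu n →L[ℝ] Eu n) :=
  ⟨ContinuousLinearMap.adjoint.continuous⟩

instance compactSpace_oGroup (n : ℕ) : CompactSpace (OGroup n) := by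
  refine (isCompact_iff_compactSpace
    (s := (unitary (Eu n →L[ℝ] Eu n) : Set (Eu n →L[ℝ] Eu n)))).mp ?_
  refine Metric.isCompact_of_isClosed_isBounded isClosed_unitary ?_
  refine (Metric.isBounded_closedBall (x := (0 : Eu n →L[ℝ] Eu n)) (r := 1)).subset ?_
  intro u hu
  rw [mem_closedBall_zero_iff]
  refine ContinuousLinearMap.opNorm_le_bound _ zero_le_one fun x => ?_
  rw [ContinuousLinearMap.norm_map_of_mem_unitary hu, one_mul]

/-- The normalized Haar measure of the orthogonal group. -/
def haarO (n : ℕ) : Measure (OGroup n) :=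
  Measure.haarMeasure (⊤ : TopologicalSpace.PositiveCompacts (OGroup n))

instance (n : ℕ) : Measure.IsHaarMeasure (haarO n) := by unfold haarO; infer_instance

instance (n : ℕ) : IsProbabilityMeasure (haarO n) :=
  ⟨by simpa [haarO] using
    Measure.haarMeasure_self (K₀ := (⊤ : TopologicalSpace.PositiveCompacts (OGroup n)))⟩

/-- Compact groups are unimodular: a right translate of Haar measure is again a Haar probability
measure, and there is only one. -/
instance (n : ℕ) : Measure.IsMulRightInvariant (haarO n) where
  map_mul_right_eq_self k := by
    have : IsProbabilityMeasure ((haarO n).map (· * k)) :=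
      Measure.isProbabilityMeasure_map (measurable_mul_const k).aemeasurable
    exact Measure.isHaarMeasure_eq_of_isProbabilityMeasure _ _

/-- The action of the orthogonal group on the sphere. -/
def rot {n : ℕ} (g : OGroup n) (x : USphere n) : USphere n :=
  ⟨(g : Eu n →L[ℝ] Eu n) x, by
    rw [mem_sphere_zero_iff_norm, ContinuousLinearMap.norm_map_of_mem_unitary g.2]; simp⟩

@[simp] theorem coe_rot {n : ℕ} (g : OGroup n) (x : USphere n) :
    (rot g x : Eu n) = (g : Eu n →L[ℝ] Eu n) x := rfl

theorem rot_mul {n : ℕ} (g h : OGroup n) (x : USphere n) : rot (g * h) x = rot g (rot h x) := rfl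

@[simp] theorem rot_one {n : ℕ} (x : USphere n) : rot 1 x = x := rfl

@[simp] theorem rot_inv_rot {n : ℕ} (g : OGroup n) (x : USphere n) : rot g⁻¹ (rot g x) = x := by
  rw [← rot_mul, inv_mul_cancel, rot_one]

@[simp] theorem rot_rot_inv {n : ℕ} (g : OGroup n) (x : USphere n) : rot g (rot g⁻¹ x) = x := by
  rw [← rot_mul, mul_inv_cancel, rot_one]

theorem inner_oGroup {n : ℕ} (g : OGroup n) (x y : Eu n) :
    ⟪(g : Eu n →L[ℝ] Eu n) x, (g : Eu n →L[ℝ] Eu n) y⟫ = ⟪x, y⟫ :=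
  ContinuousLinearMap.inner_map_map_of_mem_unitary g.2 x y

theorem norm_oGroup {n : ℕ} (g : OGroup n) (x : Eu n) : ‖(g : Eu n →L[ℝ] Eu n) x‖ = ‖x‖ :=
  ContinuousLinearMap.norm_map_of_mem_unitary g.2 x

theorem geoDist_rot {n : ℕ} (g : OGroup n) (x y : USphere n) :
    geoDist (rot g x) (rot g y) = geoDist x y := by
  simp only [geoDist, coe_rot, inner_oGroup]

theorem continuous_rot {n : ℕ} : Continuous fun p : OGroup n × USphere n => rot p.1 p.2 := by
  refine Continuous.subtype_mk ?_ _
  fun_prop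

theorem measurable_rot {n : ℕ} : Measurable fun p : OGroup n × USphere n => rot p.1 p.2 :=
  continuous_rot.measurable

theorem measurable_rot_left {n : ℕ} (x : USphere n) : Measurable fun g : OGroup n => rot g x :=
  measurable_rot.comp (measurable_id.prodMk measurable_const)

theorem measurable_rot_right {n : ℕ} (g : OGroup n) : Measurable (rot g) :=
  measurable_rot.comp (measurable_const.prodMk measurable_id)

theorem measurable_geoDist {n : ℕ} : Measurable fun p : USphere n × USphere n =>
    geoDist p.1 p.2 := by
  unfold geoDist
  exact Real.measurable_arccos.comp (by fun_prop)

/-- The reflection of `ℝⁿ` exchanging two vectors of equal length, as an orthogonal map; it fixes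
the vectors that are orthogonal to their difference. -/
theorem exists_oGroup_reflection {n : ℕ} (v w : Eu n) (h : ‖v‖ = ‖w‖) :
    ∃ g : OGroup n, (g : Eu n →L[ℝ] Eu n) v = w ∧
      ∀ u : Eu n, ⟪v - w, u⟫ = 0 → (g : Eu n →L[ℝ] Eu n) u = u := by
  refine ⟨Unitary.linearIsometryEquiv.symm (Submodule.reflection (ℝ ∙ (v - w))ᗮ), ?_, ?_⟩
  · exact Submodule.reflection_sub h
  · intro u hu
    refine Submodule.reflection_mem_subspace_eq_self ?_
    exact Submodule.mem_orthogonal_singleton_iff_inner_right.mpr hu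

theorem norm_coe_sphere {n : ℕ} (x : USphere n) : ‖(x : Eu n)‖ = 1 := by simp

theorem inner_self_sphere {n : ℕ} (x : USphere n) : ⟪(x : Eu n), (x : Eu n)⟫ = 1 := by
  rw [real_inner_self_eq_norm_sq, norm_coe_sphere]; norm_num

/-- The orthogonal group acts transitively on orthonormal pairs. -/
theorem exists_oGroup_pair {n : ℕ} {a b a' b' : Eu n} (ha : ‖a‖ = ‖a'‖)
    (hb : ‖b‖ = ‖b'‖) (hab : ⟪a, b⟫ = ⟪a', b'⟫) :
    ∃ g : OGroup n, (g : Eu n →L[ℝ] Eu n) a = a' ∧ (g : Eu n →L[ℝ] Eu n) b = b' := by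
  obtain ⟨g, hg, -⟩ := exists_oGroup_reflection a a' ha
  obtain ⟨h, hh, hfix⟩ := exists_oGroup_reflection ((g : Eu n →L[ℝ] Eu n) b) b'
    (by rw [norm_oGroup, hb])
  refine ⟨h * g, ?_, ?_⟩
  · change (h : Eu n →L[ℝ] Eu n) ((g : Eu n →L[ℝ] Eu n) a) = a'
    rw [hg]
    refine hfix a' ?_
    rw [inner_sub_left, ← hg, inner_oGroup, hg, real_inner_comm, hab, real_inner_comm, sub_self]
  · exact hh

theorem exists_rot_eq {n : ℕ} (x y : USphere n) : ∃ g : OGroup n, rot g x = y := by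
  obtain ⟨g, hg, -⟩ := exists_oGroup_reflection (x : Eu n) y (by simp)
  exact ⟨g, Subtype.ext hg⟩

/-! ### The normalized surface measure -/

-- The surface measure of `s` is a multiple of the volume of the cone over `s`, and a linear
-- isometry maps cones to cones and preserves volume.
open Pointwise in
theorem measurePreserving_rot_toSphere {n : ℕ} (g : OGroup n) :
    MeasurePreserving (rot g) (volume : Measure (Eu n)).toSphere
      (volume : Measure (Eu n)).toSphere := by
  refine ⟨measurable_rot_right g, ?_⟩
  ext s hs
  rw [Measure.map_apply (measurable_rot_right g) hs,
    Measure.toSphere_apply' _ (measurable_rot_right g hs), Measure.toSphere_apply' _ hs]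
  congr 1
  have hg := (Unitary.linearIsometryEquiv g).measurePreserving
  have hemb := (Unitary.linearIsometryEquiv g).toHomeomorph.measurableEmbedding
  rw [← hg.measure_preimage_emb hemb (Ioo (0 : ℝ) 1 • Subtype.val '' s)]
  congr 1
  ext z
  simp only [Set.mem_smul, mem_image, mem_preimage]
  constructor
  · rintro ⟨r, hr, _, ⟨x, hx, rfl⟩, rfl⟩
    exact ⟨r, hr, _, ⟨_, hx, rfl⟩, by rw [map_smul]; rfl⟩
  · rintro ⟨r, hr, _, ⟨x, hx, rfl⟩, h⟩
    refine ⟨r, hr, _, ⟨rot g⁻¹ x, by simpa using hx, rfl⟩, ?_⟩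
    apply (Unitary.linearIsometryEquiv g).injective
    rw [← h]
    have := congrArg Subtype.val (rot_rot_inv g x)
    rw [coe_rot] at this
    rw [map_smul]
    exact congrArg (r • ·) this

theorem measurePreserving_rot {n : ℕ} (g : OGroup n) :
    MeasurePreserving (rot g) (sphereσ n) (sphereσ n) :=
  (measurePreserving_rot_toSphere g).smul_measure _

theorem isProbabilityMeasure_sphereσ {n : ℕ} (hn : 0 < n) : IsProbabilityMeasure (sphereσ n) := by
  have : Nontrivial (Eu n) := by
    have : Nonempty (Fin n) := ⟨⟨0, hn⟩⟩
    infer_instance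
  refine ⟨?_⟩
  rw [sphereσ, Measure.smul_apply, smul_eq_mul]
  exact ENNReal.inv_mul_cancel (by simp [-Measure.toSphere_apply_univ]) (measure_ne_top _ _)

instance instIsProbabilityMeasureSphereσ (d : ℕ) : IsProbabilityMeasure (sphereσ (d + 1)) :=
  isProbabilityMeasure_sphereσ d.succ_pos

instance instIsOpenPosMeasureSphereσ (n : ℕ) : (sphereσ n).IsOpenPosMeasure := by
  refine ⟨fun U hU hne => ?_⟩
  rw [sphereσ, Measure.smul_apply, smul_eq_mul]
  exact mul_ne_zero (ENNReal.inv_ne_zero.mpr (measure_ne_top _ _)) (hU.measure_ne_zero _ hne)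

-- The cone over a point lies in a line, a proper subspace because `1 ≤ d`.
open Pointwise in
theorem sphereσ_singleton {d : ℕ} (hd : 1 ≤ d) (x : USphere (d + 1)) : sphereσ (d + 1) {x} = 0 := by
  rw [sphereσ, Measure.smul_apply, smul_eq_mul,
    Measure.toSphere_apply' _ (measurableSet_singleton x)]
  have : (volume : Measure (Eu (d + 1))) (Ioo (0 : ℝ) 1 • Subtype.val '' {x}) = 0 := by
    refine measure_mono_null ?_ (Measure.addHaar_submodule volume (ℝ ∙ (x : Eu (d + 1))) ?_)
    · rw [image_singleton]
      rintro _ ⟨r, -, _, rfl, rfl⟩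
      exact Submodule.smul_mem _ _ (Submodule.mem_span_singleton_self _)
    · intro h
      have h1 := finrank_span_le_card (R := ℝ) ({(x : Eu (d + 1))} : Set (Eu (d + 1)))
      rw [h, finrank_top] at h1
      simp at h1
      omega
  rw [this, mul_zero, mul_zero]

/-- The orbit map of the orthogonal group sends Haar measure to the surface measure. -/
theorem measurePreserving_orbit {d : ℕ} (x : USphere (d + 1)) :
    MeasurePreserving (fun g => rot g x) (haarO (d + 1)) (sphereσ (d + 1)) := by
  refine ⟨measurable_rot_left x, ?_⟩
  ext s hs
  rw [Measure.map_apply (measurable_rot_left x) hs]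
  have hconst : ∀ y : USphere (d + 1),
      haarO (d + 1) ((fun g => rot g y) ⁻¹' s) = haarO (d + 1) ((fun g => rot g x) ⁻¹' s) := by
    intro y
    obtain ⟨k, rfl⟩ := exists_rot_eq x y
    rw [← measure_preimage_mul_right (haarO (d + 1)) k ((fun g => rot g x) ⁻¹' s)]
    rfl
  -- The set of pairs `(g, y)` with `rot g y ∈ s` is measured by slices in both orders. The slices
  -- at fixed `g` have measure `sphereσ s` by invariance; those at fixed `y` do not depend on `y` by
  -- `hconst`.
  have hm : MeasurableSet ((fun p : OGroup (d + 1) × USphere (d + 1) => rot p.1 p.2) ⁻¹' s) :=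
    measurable_rot hs
  have h1 := Measure.prod_apply (μ := haarO (d + 1)) (ν := sphereσ (d + 1)) hm
  have h2 := Measure.prod_apply_symm (μ := haarO (d + 1)) (ν := sphereσ (d + 1)) hm
  rw [h1] at h2
  have h3 : ∀ g : OGroup (d + 1), sphereσ (d + 1) (Prod.mk g ⁻¹'
      ((fun p : OGroup (d + 1) × USphere (d + 1) => rot p.1 p.2) ⁻¹' s)) = sphereσ (d + 1) s :=
    fun g => (measurePreserving_rot g).measure_preimage hs.nullMeasurableSet
  have h4 : ∀ y : USphere (d + 1), haarO (d + 1) ((fun g => (g, y)) ⁻¹'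
      ((fun p : OGroup (d + 1) × USphere (d + 1) => rot p.1 p.2) ⁻¹' s)) =
      haarO (d + 1) ((fun g => rot g x) ⁻¹' s) := hconst
  simp only [h3, h4, lintegral_const, measure_univ, mul_one] at h2
  exact h2.symm

theorem measurePreserving_action (d : ℕ) :
    MeasurePreserving (fun p : OGroup (d + 1) × USphere (d + 1) => rot p.1 p.2)
      ((haarO (d + 1)).prod (sphereσ (d + 1))) (sphereσ (d + 1)) := by
  refine ⟨measurable_rot, ?_⟩
  ext s hs
  rw [Measure.map_apply measurable_rot hs, Measure.prod_apply (measurable_rot hs)]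
  have h3 : ∀ g : OGroup (d + 1), sphereσ (d + 1) (Prod.mk g ⁻¹'
      ((fun p : OGroup (d + 1) × USphere (d + 1) => rot p.1 p.2) ⁻¹' s)) = sphereσ (d + 1) s :=
    fun g => (measurePreserving_rot g).measure_preimage hs.nullMeasurableSet
  simp only [h3, lintegral_const, measure_univ, mul_one]

/-- Integration over pairs of points of the sphere, by averaging over the orthogonal group the
pairs with one point equal to a fixed one. -/
theorem lintegral_prod_sphere_eq {d : ℕ} (p : USphere (d + 1))
    {H : USphere (d + 1) × USphere (d + 1) → ℝ≥0∞} (hH : Measurable H) :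
    ∫⁻ z, H z ∂((sphereσ (d + 1)).prod (sphereσ (d + 1))) =
      ∫⁻ y, ∫⁻ g, H (rot g p, rot g y) ∂(haarO (d + 1)) ∂(sphereσ (d + 1)) := by
  rw [lintegral_prod _ hH.aemeasurable,
    ← (measurePreserving_orbit p).lintegral_comp hH.lintegral_prod_right']
  have : ∀ g : OGroup (d + 1), ∫⁻ y, H (rot g p, y) ∂(sphereσ (d + 1)) =
      ∫⁻ y, H (rot g p, rot g y) ∂(sphereσ (d + 1)) := fun g =>
    ((measurePreserving_rot g).lintegral_comp (hH.comp measurable_prodMk_left)).symm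
  simp only [this]
  rw [lintegral_lintegral_swap]
  refine (hH.comp ?_).aemeasurable
  exact ((measurable_rot_left p).comp measurable_fst).prodMk measurable_rot

/-! ### Integrals against the zonal kernels `(1 + ⟨x, z⟩) ^ m` -/

section Zonal

variable {n : ℕ} {F : Type} [NormedAddCommGroup F] [NormedSpace ℝ F]

/-- The integral of `a` over the unit sphere against the kernel `(1 + ⟨x, z⟩) ^ m`, as a function
of the point `z` of the ambient space. -/
def zonalInt (m : ℕ) (a : USphere n → F) (z : Eu n) : F :=
  ∫ x, (1 + ⟪(x : Eu n), z⟫) ^ m • a x ∂(sphereσ n)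

instance instIsFiniteMeasureSphereσ (n : ℕ) : IsFiniteMeasure (sphereσ n) := by
  cases n with
  | zero =>
    refine ⟨?_⟩
    have : (univ : Set (USphere 0)) = ∅ := by
      ext x
      have h := norm_coe_sphere x
      rw [Subsingleton.elim (x : Eu 0) 0, norm_zero] at h
      exact absurd h zero_ne_one
    rw [this, measure_empty]
    exact ENNReal.zero_lt_top
  | succ d => infer_instance

theorem continuous_zonalKernel (m : ℕ) (z : Eu n) :
    Continuous fun x : USphere n => (1 + ⟪(x : Eu n), z⟫) ^ m := by fun_prop

theorem abs_one_add_inner_le (x : USphere n) (z : Eu n) : |1 + ⟪(x : Eu n), z⟫| ≤ 1 + ‖z‖ := by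
  have h := abs_real_inner_le_norm (x : Eu n) z
  rw [norm_coe_sphere, one_mul] at h
  exact (abs_add_le _ _).trans (by rw [abs_one]; linarith)

theorem one_add_inner_nonneg (x y : USphere n) : 0 ≤ 1 + ⟪(x : Eu n), (y : Eu n)⟫ := by
  have h := abs_real_inner_le_norm (x : Eu n) y
  rw [norm_coe_sphere, norm_coe_sphere, one_mul] at h
  linarith [(abs_le.mp h).1]

theorem integrable_zonal (m : ℕ) {a : USphere n → F} (ha : Integrable a (sphereσ n)) (z : Eu n) :
    Integrable (fun x : USphere n => (1 + ⟪(x : Eu n), z⟫) ^ m • a x) (sphereσ n) := by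
  refine ha.bdd_smul ((1 + ‖z‖) ^ m)
    (continuous_zonalKernel m z).aestronglyMeasurable ?_
  filter_upwards with x
  rw [norm_pow, Real.norm_eq_abs]
  exact pow_le_pow_left₀ (abs_nonneg _) (abs_one_add_inner_le x z) m

theorem zonalInt_map {F' : Type} [NormedAddCommGroup F'] [NormedSpace ℝ F'] [CompleteSpace F]
    [CompleteSpace F'] (L : F →L[ℝ] F') (m : ℕ) {a : USphere n → F}
    (ha : Integrable a (sphereσ n)) (z : Eu n) :
    L (zonalInt m a z) = zonalInt m (fun x => L (a x)) z := by
  rw [zonalInt, ← L.integral_comp_comm (integrable_zonal m ha z)]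
  simp only [map_smul, zonalInt]

theorem integrable_rankOne {a : USphere n → F} (ha : Integrable a (sphereσ n)) :
    Integrable (fun x : USphere n => (innerSL ℝ (x : Eu n)).smulRight (a x)) (sphereσ n) := by
  refine Integrable.mono' ha.norm ?_ ?_
  · exact (ContinuousLinearMap.smulRightL ℝ (Eu n) F).aestronglyMeasurable_comp₂
      (by fun_prop : Continuous fun x : USphere n => innerSL ℝ (x : Eu n)).aestronglyMeasurable
      ha.aestronglyMeasurable
  · filter_upwards with x
    rw [ContinuousLinearMap.norm_smulRight_apply, innerSL_apply_norm, norm_coe_sphere, one_mul]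

/-- Differentiation under the integral sign lowers the exponent by one and turns the coefficient
into a rank-one map, so the derivative is again a zonal integral. The truncated `m - 1` is harmless
at `m = 0`, where the factor `m` vanishes. -/
theorem hasFDerivAt_zonalInt (m : ℕ) {a : USphere n → F} (ha : Integrable a (sphereσ n))
    (z : Eu n) : HasFDerivAt (zonalInt m a)
      ((m : ℝ) • zonalInt (m - 1) (fun x => (innerSL ℝ (x : Eu n)).smulRight (a x)) z) z := by
  have hR := integrable_rankOne ha
  have hdiff : ∀ x : USphere n, ∀ y : Eu n,
      HasFDerivAt (fun y => (1 + ⟪(x : Eu n), y⟫) ^ m • a x)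
        ((m : ℝ) • (1 + ⟪(x : Eu n), y⟫) ^ (m - 1) •
          (innerSL ℝ (x : Eu n)).smulRight (a x)) y := by
    intro x y
    have h1 : HasFDerivAt (fun y => 1 + ⟪(x : Eu n), y⟫) (innerSL ℝ (x : Eu n)) y :=
      ((innerSL ℝ (x : Eu n)).hasFDerivAt).const_add 1
    have h2 := (h1.pow m).smul_const (a x)
    refine h2.congr_fderiv ?_
    ext h
    simp [smul_smul, mul_assoc]
  have key := hasFDerivAt_integral_of_dominated_of_fderiv_le (μ := sphereσ n) (𝕜 := ℝ)
    (F := fun (y : Eu n) (x : USphere n) => (1 + ⟪(x : Eu n), y⟫) ^ m • a x)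
    (F' := fun y x => (m : ℝ) • (1 + ⟪(x : Eu n), y⟫) ^ (m - 1) •
          (innerSL ℝ (x : Eu n)).smulRight (a x)) (x₀ := z) (s := ball z 1)
    (bound := fun x => m * (1 + (‖z‖ + 1)) ^ (m - 1) * ‖a x‖)
    (ball_mem_nhds z one_pos)
    (Eventually.of_forall fun y => (integrable_zonal m ha y).aestronglyMeasurable)
    (integrable_zonal m ha z)
    ((integrable_zonal (m - 1) hR z).smul (m : ℝ)).aestronglyMeasurable ?_
    (ha.norm.const_mul _) (ae_of_all _ fun x y _ => hdiff x y)
  · refine key.congr_fderiv ?_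
    rw [integral_smul]
    rfl
  · filter_upwards with x y hy
    rw [norm_smul, norm_smul, ContinuousLinearMap.norm_smulRight_apply, innerSL_apply_norm,
      norm_coe_sphere, one_mul, norm_pow, Real.norm_eq_abs, Real.norm_eq_abs, Nat.abs_cast,
      ← mul_assoc]
    gcongr
    refine (abs_one_add_inner_le x y).trans ?_
    have : ‖y‖ ≤ ‖z‖ + ‖y - z‖ := norm_le_norm_add_norm_sub' y z
    rw [mem_ball, dist_eq_norm] at hy
    linarith

/-- The coefficient space is quantified inside the induction, because each derivative replaces `F`
by the linear maps into `F`. -/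
theorem contDiff_zonalInt (m : ℕ) : ∀ {F : Type} [NormedAddCommGroup F] [NormedSpace ℝ F]
    {a : USphere n → F}, Integrable a (sphereσ n) → ContDiff ℝ ∞ (zonalInt m a) := by
  induction m with
  | zero =>
    intro F _ _ a ha
    have : zonalInt 0 a = fun _ => ∫ x, a x ∂(sphereσ n) := by
      ext z; simp [zonalInt]
    rw [this]
    exact contDiff_const
  | succ m ih =>
    intro F _ _ a ha
    rw [contDiff_infty_iff_fderiv]
    refine ⟨fun z => (hasFDerivAt_zonalInt _ ha z).differentiableAt, ?_⟩
    have : fderiv ℝ (zonalInt (m + 1) a) = fun z => ((m + 1 : ℕ) : ℝ) •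
        zonalInt m (fun x => (innerSL ℝ (x : Eu n)).smulRight (a x)) z := by
      ext1 z
      exact (hasFDerivAt_zonalInt _ ha z).fderiv
    rw [this]
    exact (ih (integrable_rankOne ha)).const_smul ((m + 1 : ℕ) : ℝ)

end Zonal

/-! ### The spherical divergence -/

/-- The trace over the tangent space at `y`, as a linear functional. -/
def tangentTrace {n : ℕ} (y : Eu n) : (Eu n →L[ℝ] Eu n) →L[ℝ] ℝ :=
  LinearMap.toContinuousLinearMap
    ((LinearMap.trace ℝ (Eu n)) ∘ₗ (ContinuousLinearMap.coeLM ℝ) -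
      (innerSL ℝ y : Eu n →ₗ[ℝ] ℝ) ∘ₗ
        ((ContinuousLinearMap.apply ℝ (Eu n) y : (Eu n →L[ℝ] Eu n) →L[ℝ] Eu n) :
          (Eu n →L[ℝ] Eu n) →ₗ[ℝ] Eu n))

theorem tangentTrace_apply {n : ℕ} (y : Eu n) (D : Eu n →L[ℝ] Eu n) :
    tangentTrace y D = LinearMap.trace ℝ (Eu n) (D : Eu n →ₗ[ℝ] Eu n) - ⟪D y, y⟫ := by
  simp [tangentTrace, real_inner_comm]

theorem sphereDiv_eq {n : ℕ} (X : Eu n → Eu n) (x : USphere n) :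
    sphereDiv X x = tangentTrace x (fderiv ℝ X x) := by
  rw [tangentTrace_apply, sphereDiv]

theorem trace_smulRight {n : ℕ} (φ : Eu n →L[ℝ] ℝ) (b : Eu n) :
    LinearMap.trace ℝ (Eu n) (φ.smulRight b : Eu n →L[ℝ] Eu n) = φ b := by
  rw [LinearMap.trace_eq_sum_inner _ (EuclideanSpace.basisFun (Fin n) ℝ)]
  conv_rhs => rw [← (EuclideanSpace.basisFun (Fin n) ℝ).sum_repr' b, map_sum]
  refine Finset.sum_congr rfl fun i _ => ?_
  simp only [ContinuousLinearMap.coe_coe, ContinuousLinearMap.smulRight_apply, inner_smul_right,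
    map_smul, smul_eq_mul]
  ring

theorem tangentTrace_smulRight {n : ℕ} (y : Eu n) (φ : Eu n →L[ℝ] ℝ) (b : Eu n) :
    tangentTrace y (φ.smulRight b) = φ b - φ y * ⟪b, y⟫ := by
  rw [tangentTrace_apply, trace_smulRight, ContinuousLinearMap.smulRight_apply, inner_smul_left]
  simp

theorem tangentTrace_id {n : ℕ} (y : USphere n) :
    tangentTrace (y : Eu n) (ContinuousLinearMap.id ℝ (Eu n)) = n - 1 := by
  rw [tangentTrace_apply]
  have : LinearMap.trace ℝ (Eu n) ((ContinuousLinearMap.id ℝ (Eu n) : Eu n →L[ℝ] Eu n) :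
      Eu n →ₗ[ℝ] Eu n) = n := by
    simp
  rw [this, ContinuousLinearMap.id_apply, inner_self_sphere]

/-! ### Mollification by zonal polynomials -/

section Mollifier

variable {d : ℕ}

/-- A base point of the unit sphere. -/
def pole (d : ℕ) : USphere (d + 1) :=
  ⟨EuclideanSpace.single 0 1, by simp⟩

theorem zonalInt_rot {n : ℕ} {F : Type} [NormedAddCommGroup F] [NormedSpace ℝ F] (m : ℕ)
    (a : USphere n → F) (g : OGroup n) (y : Eu n) :
    zonalInt m a ((g : Eu n →L[ℝ] Eu n) y) = zonalInt m (fun x => a (rot g x)) y := by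
  have hemb : MeasurableEmbedding (rot g) :=
    MeasurableEquiv.measurableEmbedding
      { toFun := rot g, invFun := rot g⁻¹, left_inv := rot_inv_rot g, right_inv := rot_rot_inv g,
        measurable_toFun := measurable_rot_right g,
        measurable_invFun := measurable_rot_right g⁻¹ }
  rw [zonalInt, ← (measurePreserving_rot g).integral_comp hemb]
  simp only [coe_rot, inner_oGroup, zonalInt]

/-- The total mass of the kernel `(1 + ⟨x, y⟩) ^ m`. -/
def zonalMass (d m : ℕ) : ℝ := zonalInt m (fun _ : USphere (d + 1) => (1 : ℝ)) (pole d)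

theorem zonalMass_eq (m : ℕ) (y : USphere (d + 1)) :
    ∫ x : USphere (d + 1), (1 + ⟪(x : Eu (d + 1)), (y : Eu (d + 1))⟫) ^ m ∂(sphereσ (d + 1)) =
      zonalMass d m := by
  obtain ⟨g, rfl⟩ := exists_rot_eq (pole d) y
  have h := zonalInt_rot m (fun _ : USphere (d + 1) => (1 : ℝ)) g (pole d)
  rw [zonalMass, ← h]
  simp [zonalInt]

theorem integrable_zonalKernel {n : ℕ} (m : ℕ) (y : Eu n) :
    Integrable (fun x : USphere n => (1 + ⟪(x : Eu n), y⟫) ^ m) (sphereσ n) := by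
  simpa using integrable_zonal m (integrable_const (1 : ℝ) (μ := sphereσ n)) y

theorem zonalMass_pos (d m : ℕ) : 0 < zonalMass d m := by
  rw [← zonalMass_eq m (pole d)]
  refine Continuous.integral_pos_of_hasCompactSupport_nonneg_nonzero
    (continuous_zonalKernel m (pole d : Eu (d + 1)))
    (HasCompactSupport.of_compactSpace _)
    (fun x => pow_nonneg (one_add_inner_nonneg x _) m) (x := pole d) ?_
  rw [inner_self_sphere]
  positivity

/-- The mollification of `f` by the normalized kernel `(1 + ⟨x, z⟩) ^ (k + 2)`. -/
def moll (f : USphere (d + 1) → ℝ) (k : ℕ) (z : Eu (d + 1)) : ℝ :=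
  (zonalMass d (k + 2))⁻¹ * zonalInt (k + 2) f z

/-- The gradient, in the ambient space, of the mollification. -/
def mollGrad (f : USphere (d + 1) → ℝ) (k : ℕ) (z : Eu (d + 1)) : Eu (d + 1) :=
  ((zonalMass d (k + 2))⁻¹ * (k + 2)) •
    zonalInt (k + 1) (fun x : USphere (d + 1) => f x • (x : Eu (d + 1))) z

theorem integrable_smul_coe {n : ℕ} {f : USphere n → ℝ} (hf : Integrable f (sphereσ n)) :
    Integrable (fun x : USphere n => f x • (x : Eu n)) (sphereσ n) := by
  refine hf.mono ?_ ?_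
  · exact hf.aestronglyMeasurable.smul continuous_subtype_val.aestronglyMeasurable
  · filter_upwards with x
    rw [norm_smul, norm_coe_sphere, mul_one]

theorem contDiff_moll {f : USphere (d + 1) → ℝ} (hf : Integrable f (sphereσ (d + 1))) (k : ℕ) :
    ContDiff ℝ ∞ (moll f k) :=
  contDiff_const.mul (contDiff_zonalInt _ hf)

theorem contDiff_mollGrad {f : USphere (d + 1) → ℝ} (hf : Integrable f (sphereσ (d + 1)))
    (k : ℕ) : ContDiff ℝ ∞ (mollGrad f k) :=
  (contDiff_zonalInt _ (integrable_smul_coe hf)).const_smul _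

theorem hasFDerivAt_moll {f : USphere (d + 1) → ℝ} (hf : Integrable f (sphereσ (d + 1))) (k : ℕ)
    (z : Eu (d + 1)) : HasFDerivAt (moll f k) (innerSL ℝ (mollGrad f k z)) z := by
  refine ((hasFDerivAt_zonalInt (k + 2) hf z).const_mul _).congr_fderiv ?_
  ext h
  have h1 := zonalInt_map (ContinuousLinearMap.apply ℝ ℝ h) (k + 1) (integrable_rankOne hf) z
  have h2 := zonalInt_map (innerSL ℝ h) (k + 1) (integrable_smul_coe hf) z
  simp only [ContinuousLinearMap.apply_apply, ContinuousLinearMap.smulRight_apply,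
    innerSL_apply_apply, smul_eq_mul, inner_smul_right] at h1 h2
  rw [innerSL_apply_apply, real_inner_comm, mollGrad, inner_smul_right, h2]
  simp only [_root_.smul_apply, Nat.add_one_sub_one, smul_eq_mul, h1]
  push_cast
  rw [mul_assoc]
  congr 3
  ext x
  rw [real_inner_comm, mul_comm]

/-! ### Transport of a tangent field by the zonal kernel -/

/-- The average of the values of a tangent field `X`, transported from `x` to `z` along the
geodesics, against the kernel `(1 + ⟨x, z⟩) ^ (k + 2)`. -/
def transportField {n : ℕ} (k : ℕ) (X : USphere n → Eu n) (z : Eu n) : Eu n :=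
  zonalInt (k + 2) X z -
    zonalInt (k + 1) (fun x => (innerSL ℝ (X x)).smulRight (x : Eu n)) z z -
    ⟪zonalInt (k + 1) X z, z⟫ • z

variable {n : ℕ} {X : USphere n → Eu n}

theorem integrable_smulRight_coe (hX : Integrable X (sphereσ n)) :
    Integrable (fun x => (innerSL ℝ (X x)).smulRight (x : Eu n)) (sphereσ n) := by
  refine Integrable.mono' hX.norm ?_ ?_
  · exact (ContinuousLinearMap.smulRightL ℝ (Eu n) (Eu n)).aestronglyMeasurable_comp₂
      ((innerSL ℝ).continuous.comp_aestronglyMeasurable hX.aestronglyMeasurable)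
      continuous_subtype_val.aestronglyMeasurable
  · filter_upwards with x
    rw [ContinuousLinearMap.norm_smulRight_apply, innerSL_apply_norm, norm_coe_sphere, mul_one]

theorem contDiff_transportField (hX : Integrable X (sphereσ n)) (k : ℕ) :
    ContDiff ℝ ∞ (transportField k X) := by
  have h1 : ContDiff ℝ ∞ (zonalInt (k + 1) X) := contDiff_zonalInt _ hX
  have h2 : ContDiff ℝ ∞ (zonalInt (k + 2) X) := contDiff_zonalInt _ hX
  have h3 := contDiff_zonalInt (k + 1) (integrable_smulRight_coe hX)
  exact (h2.sub (h3.clm_apply contDiff_id)).sub ((h1.inner ℝ contDiff_id).smul contDiff_id)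

theorem integrable_transport (hX : Integrable X (sphereσ n)) (k : ℕ) (z : Eu n) :
    Integrable (fun x : USphere n => (1 + ⟪(x : Eu n), z⟫) ^ (k + 1) •
      ((1 + ⟪(x : Eu n), z⟫) • X x - ⟪X x, z⟫ • ((x : Eu n) + z))) (sphereσ n) := by
  refine integrable_zonal (k + 1) (Integrable.sub ?_ ?_) z
  · simpa using integrable_zonal 1 hX z
  · simp only [smul_add]
    exact (integrable_smul_coe (hX.inner_const z)).add ((hX.inner_const z).smul_const z)

/-- The definition keeps three zonal integrals apart, so that each can be differentiated; collected
under one integral they show the transported vectors, from which length and tangency are read off.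
-/
theorem transportField_eq_integral (hX : Integrable X (sphereσ n)) (k : ℕ) (z : Eu n) :
    transportField k X z = ∫ x, ((1 + ⟪(x : Eu n), z⟫) ^ (k + 1) •
      ((1 + ⟪(x : Eu n), z⟫) • X x - ⟪X x, z⟫ • ((x : Eu n) + z))) ∂(sphereσ n) := by
  have hT := integrable_smulRight_coe hX
  have h1 := zonalInt_map (ContinuousLinearMap.apply ℝ (Eu n) z) (k + 1) hT z
  have h2 := zonalInt_map ((innerSL ℝ z).smulRight z) (k + 1) hX z
  simp only [ContinuousLinearMap.apply_apply, ContinuousLinearMap.smulRight_apply,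
    innerSL_apply_apply] at h1 h2
  rw [transportField, h1, real_inner_comm, h2, zonalInt, zonalInt, zonalInt, ← integral_sub,
    ← integral_sub]
  · congr 1
    ext1 x
    rw [pow_succ _ (k + 1), real_inner_comm z (X x)]
    module
  · refine (integrable_zonal (k + 2) hX z).sub (integrable_zonal (k + 1) ?_ z)
    exact hT.apply_continuousLinearMap z
  · refine integrable_zonal (k + 1) ?_ z
    exact (hX.const_inner z).smul_const z
  · exact integrable_zonal (k + 2) hX z
  · exact integrable_zonal (k + 1) (hT.apply_continuousLinearMap z) z

/-- For `y ≠ -x`, parallel transport along the geodesic sends `v` to `v - ⟪v, y⟫ / (1 + ⟪x, y⟫) • (x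
+ y)` and is isometric. Multiplying by `1 + ⟪x, y⟫` clears the denominator and covers the antipode.
-/
theorem norm_transport (x y : USphere n) {v : Eu n} (hv : ⟪v, (x : Eu n)⟫ = 0) :
    ‖(1 + ⟪(x : Eu n), (y : Eu n)⟫) • v - ⟪v, (y : Eu n)⟫ • ((x : Eu n) + y)‖ =
      (1 + ⟪(x : Eu n), (y : Eu n)⟫) * ‖v‖ := by
  have h0 := one_add_inner_nonneg x y
  rw [← sq_eq_sq₀ (norm_nonneg _) (by positivity), ← real_inner_self_eq_norm_sq, mul_pow,
    ← real_inner_self_eq_norm_sq]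
  have hv' : ⟪(x : Eu n), v⟫ = 0 := by rw [real_inner_comm]; exact hv
  have hc := real_inner_comm (x : Eu n) (y : Eu n)
  have hd := real_inner_comm v (y : Eu n)
  simp only [inner_sub_left, inner_sub_right, inner_add_left, inner_add_right, inner_smul_left,
    inner_smul_right, inner_self_sphere, hv, hv', conj_trivial, hc, hd]
  ring

theorem norm_transportField_le {X : USphere (d + 1) → Eu (d + 1)}
    (hX : Integrable X (sphereσ (d + 1)))
    (htan : ∀ x, ⟪X x, (x : Eu (d + 1))⟫ = 0) (hle : ∀ x, ‖X x‖ ≤ 1) (k : ℕ)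
    (y : USphere (d + 1)) : ‖transportField k X y‖ ≤ zonalMass d (k + 2) := by
  rw [transportField_eq_integral hX, ← zonalMass_eq (k + 2) y]
  refine norm_integral_le_of_norm_le (integrable_zonalKernel _ _) (ae_of_all _ fun x => ?_)
  have h0 := one_add_inner_nonneg x y
  rw [norm_smul, norm_transport x y (htan x), norm_pow, Real.norm_of_nonneg h0,
    pow_succ _ (k + 1)]
  gcongr
  exact mul_le_of_le_one_right h0 (hle x)

theorem inner_transportField (hX : Integrable X (sphereσ n)) (k : ℕ) (y : USphere n) :
    ⟪transportField k X y, (y : Eu n)⟫ = 0 := by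
  rw [transportField_eq_integral hX, real_inner_comm,
    ← integral_inner (integrable_transport hX k _)]
  rw [← integral_zero (USphere n) ℝ]
  congr 1
  ext1 x
  simp only [inner_smul_right, inner_sub_right, inner_add_right, inner_self_sphere,
    real_inner_comm (y : Eu n)]
  ring

/-- The derivative of `φ` contributes nothing, as its rank-one term has range along the normal `y`;
the identity has tangential trace `n - 1`. -/
theorem sphereDiv_smul_self {φ : Eu n → ℝ} (y : USphere n)
    (hφ : DifferentiableAt ℝ φ y) : sphereDiv (fun z => φ z • z) y = φ y * (n - 1) := by
  have h : HasFDerivAt (fun z => φ z • z) _ (y : Eu n) :=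
    hφ.hasFDerivAt.smul (hasFDerivAt_id (y : Eu n))
  have := tangentTrace_smulRight (y : Eu n) (fderiv ℝ φ y) y
  rw [inner_self_sphere, mul_one, sub_self] at this
  rw [sphereDiv_eq, h.fderiv, map_add, map_smul, tangentTrace_id]
  erw [this]
  rw [add_zero, smul_eq_mul]

theorem sphereDiv_sub {X Y : Eu n → Eu n} {y : USphere n} (hX : DifferentiableAt ℝ X y)
    (hY : DifferentiableAt ℝ Y y) :
    sphereDiv (fun z => X z - Y z) y = sphereDiv X y - sphereDiv Y y := by
  rw [sphereDiv_eq, fderiv_fun_sub hX hY, map_sub, ← sphereDiv_eq, ← sphereDiv_eq]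

theorem sphereDiv_const_smul {X : Eu n → Eu n} {y : USphere n} (hX : DifferentiableAt ℝ X y)
    (c : ℝ) : sphereDiv (fun z => c • X z) y = c * sphereDiv X y := by
  rw [sphereDiv_eq, fderiv_fun_const_smul hX, map_smul, ← sphereDiv_eq, smul_eq_mul]

theorem sphereDiv_zonalInt (m : ℕ) {a : USphere n → Eu n} (ha : Integrable a (sphereσ n))
    (y : USphere n) : sphereDiv (zonalInt m a) y =
      m * zonalInt (m - 1) (fun x => ⟪(x : Eu n), a x⟫ -
        ⟪(x : Eu n), (y : Eu n)⟫ * ⟪a x, (y : Eu n)⟫) y := by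
  rw [sphereDiv_eq, (hasFDerivAt_zonalInt m ha (y : Eu n)).fderiv, map_smul,
    zonalInt_map _ _ (integrable_rankOne ha), smul_eq_mul]
  simp only [tangentTrace_smulRight, innerSL_apply_apply]

instance completeSpace_bilin (n : ℕ) : CompleteSpace (Eu n →L[ℝ] Eu n →L[ℝ] Eu n) :=
  FiniteDimensional.complete ℝ _

theorem sphereDiv_zonalInt_apply_self (m : ℕ) {a : USphere n → Eu n →L[ℝ] Eu n}
    (ha : Integrable a (sphereσ n)) (y : USphere n) :
    sphereDiv (fun z => zonalInt m a z z) y =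
      zonalInt m (fun x => tangentTrace (y : Eu n) (a x)) y +
      m * zonalInt (m - 1) (fun x => ⟪(x : Eu n), a x y⟫ -
        ⟪(x : Eu n), (y : Eu n)⟫ * ⟪a x y, (y : Eu n)⟫) y := by
  have hR := integrable_rankOne ha
  have h2 : HasFDerivAt (fun z => zonalInt m a z z) _ (y : Eu n) :=
    (hasFDerivAt_zonalInt m ha (y : Eu n)).clm_apply (hasFDerivAt_id (y : Eu n))
  have e2 := zonalInt_map ((tangentTrace (y : Eu n)).comp
    (ContinuousLinearMap.compL ℝ (Eu n) (Eu n →L[ℝ] Eu n) (Eu n)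
      (ContinuousLinearMap.apply ℝ (Eu n) (y : Eu n)))) (m - 1) hR (y : Eu n)
  rw [sphereDiv_eq, h2.fderiv, map_add, ContinuousLinearMap.comp_id, zonalInt_map _ _ ha]
  congr 1
  have e3 : ((m : ℝ) • zonalInt (m - 1)
      (fun x => (innerSL ℝ (x : Eu n)).smulRight (a x)) (y : Eu n)).flip (y : Eu n) =
      (m : ℝ) • (ContinuousLinearMap.apply ℝ (Eu n) (y : Eu n)).comp (zonalInt (m - 1)
      (fun x => (innerSL ℝ (x : Eu n)).smulRight (a x)) (y : Eu n)) := by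
    ext1 h
    simp
  have e4 : ∀ x : USphere n, (ContinuousLinearMap.apply ℝ (Eu n) (y : Eu n)).comp
      ((innerSL ℝ (x : Eu n)).smulRight (a x)) =
      (innerSL ℝ (x : Eu n)).smulRight (a x y) := by
    intro x
    ext1 h
    simp
  simp only [ContinuousLinearMap.comp_apply, ContinuousLinearMap.compL_apply, e4,
    tangentTrace_smulRight, innerSL_apply_apply] at e2
  rw [e3, map_smul, smul_eq_mul, e2]

/-- With `t = ⟪x, y⟫`, the identity `(1 + t) ^ k * (1 - t ^ 2) = (1 + t) ^ (k + 1) * (1 - t)`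
reduces all terms to the integrals of `s` and `t s` against `(1 + t) ^ (k + 1)`. The latter has
total coefficient `-(k + 2) + 1 + (k + 1) = 0`. -/
theorem zonalInt_combination (k : ℕ) {s : USphere n → ℝ} (hs : Integrable s (sphereσ n))
    (y : USphere n) :
    ((k + 2 : ℕ) : ℝ) * zonalInt (k + 1)
        (fun x : USphere n => 0 - ⟪(x : Eu n), (y : Eu n)⟫ * s x) (y : Eu n) -
      (zonalInt (k + 1) (fun x : USphere n => 0 - s x * ⟪(x : Eu n), (y : Eu n)⟫) (y : Eu n) +
        ((k + 1 : ℕ) : ℝ) * zonalInt k (fun x : USphere n => s x * 1 -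
          ⟪(x : Eu n), (y : Eu n)⟫ * (s x * ⟪(x : Eu n), (y : Eu n)⟫)) (y : Eu n)) -
      zonalInt (k + 1) s (y : Eu n) * (n - 1) = -((k + n : ℝ) * zonalInt (k + 1) s (y : Eu n)) := by
  set A := zonalInt (k + 1) (fun x : USphere n => s x * ⟪(x : Eu n), (y : Eu n)⟫) (y : Eu n) with hA
  have iI := integrable_zonal (k + 1) hs (y : Eu n)
  have iA : Integrable (fun x : USphere n => (1 + ⟪(x : Eu n), (y : Eu n)⟫) ^ (k + 1) •
      (s x * ⟪(x : Eu n), (y : Eu n)⟫)) (sphereσ n) := by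
    have h : Integrable (fun x : USphere n => s x * ⟪(x : Eu n), (y : Eu n)⟫) (sphereσ n) :=
      ((integrable_smul_coe hs).inner_const (y : Eu n)).congr
        (ae_of_all _ fun x => real_inner_smul_left _ _ _)
    exact integrable_zonal (k + 1) h (y : Eu n)
  have z2 : zonalInt (k + 1) (fun x : USphere n => 0 - s x *
      ⟪(x : Eu n), (y : Eu n)⟫) (y : Eu n) = -A := by
    rw [hA, zonalInt, zonalInt, ← integral_neg]
    congr 1
    ext1 x
    rw [zero_sub, smul_neg]
  have z3 : zonalInt k (fun x : USphere n => s x * 1 -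
      ⟪(x : Eu n), (y : Eu n)⟫ * (s x * ⟪(x : Eu n), (y : Eu n)⟫)) (y : Eu n) =
      zonalInt (k + 1) s (y : Eu n) - A := by
    rw [hA, zonalInt, zonalInt, zonalInt, ← integral_sub iI iA]
    congr 1
    ext1 x
    simp only [smul_eq_mul, pow_succ]
    ring
  simp only [mul_comm _ (s _)]
  rw [z2]
  simp only [mul_comm (s _)] at z3 ⊢
  rw [z3]
  push_cast
  ring

theorem transportField_sphereDiv_split (hX : Integrable X (sphereσ n)) (k : ℕ) (y : USphere n) :
    sphereDiv (transportField k X) y = sphereDiv (zonalInt (k + 2) X) y -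
      sphereDiv (fun z : Eu n => zonalInt (k + 1)
        (fun x => (innerSL ℝ (X x)).smulRight (x : Eu n)) z z) y -
      ⟪zonalInt (k + 1) X y, (y : Eu n)⟫ * (n - 1) := by
  have hT := integrable_smulRight_coe hX
  have hφ : DifferentiableAt ℝ (fun z => ⟪zonalInt (k + 1) X z, z⟫) (y : Eu n) :=
    ((hasFDerivAt_zonalInt (k + 1) hX (y : Eu n)).differentiableAt).inner ℝ differentiableAt_id
  have d1 := (hasFDerivAt_zonalInt (k + 2) hX (y : Eu n)).differentiableAt
  have d2 : DifferentiableAt ℝ (fun z : Eu n => zonalInt (k + 1)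
      (fun x => (innerSL ℝ (X x)).smulRight (x : Eu n)) z z) (y : Eu n) :=
    ((hasFDerivAt_zonalInt (k + 1) hT (y : Eu n)).differentiableAt).clm_apply differentiableAt_id
  have d3 : DifferentiableAt ℝ (fun z : Eu n => ⟪zonalInt (k + 1) X z, z⟫ • z) (y : Eu n) :=
    hφ.fun_smul differentiableAt_id
  rw [← sphereDiv_smul_self y hφ, ← sphereDiv_sub d1 d2, ← sphereDiv_sub (d1.fun_sub d2) d3]
  rfl

/-- Up to a constant, the integrand is the derivative of the kernel `(1 + ⟪x, y⟫) ^ (k + 2)` in the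
variable `x` along `X x`: divergence in `y` after transport is turned into a derivative in `x`. This
makes transport dual to mollification. -/
theorem sphereDiv_transportField (hX : Integrable X (sphereσ n))
    (htan : ∀ x, ⟪X x, (x : Eu n)⟫ = 0) (k : ℕ) (y : USphere n) :
    sphereDiv (transportField k X) y =
      -((k + n : ℝ) * ∫ x, (1 + ⟪(x : Eu n), (y : Eu n)⟫) ^ (k + 1) * ⟪X x, (y : Eu n)⟫
        ∂(sphereσ n)) := by
  have hin := zonalInt_map (innerSL ℝ (y : Eu n)) (k + 1) hX y
  simp only [innerSL_apply_apply, fun x => real_inner_comm (X x) (y : Eu n)] at hin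
  have htan' : ∀ x : USphere n, ⟪(x : Eu n), X x⟫ = 0 := fun x =>
    (real_inner_comm (X x) (x : Eu n)).trans (htan x)
  rw [transportField_sphereDiv_split hX, sphereDiv_zonalInt _ hX,
    sphereDiv_zonalInt_apply_self _ (integrable_smulRight_coe hX), real_inner_comm, hin]
  simp only [ContinuousLinearMap.smulRight_apply, innerSL_apply_apply, tangentTrace_smulRight,
    inner_smul_right, inner_smul_left, inner_self_sphere, conj_trivial, htan, htan']
  exact zonalInt_combination k (hX.inner_const (y : Eu n)) y

/-! ### Variation of the mollifications, by duality -/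

theorem continuous_mollGrad {f : USphere (d + 1) → ℝ} (hf : Integrable f (sphereσ (d + 1)))
    (k : ℕ) : Continuous fun x : USphere (d + 1) => mollGrad f k x :=
  (contDiff_mollGrad hf k).continuous.comp continuous_subtype_val

/-- The orthogonal projection of a vector to the tangent space at `x`. -/
def tangentPart {n : ℕ} (x : Eu n) (v : Eu n) : Eu n := v - ⟪v, x⟫ • x

theorem inner_tangentPart {n : ℕ} (x : USphere n) (v : Eu n) :
    ⟪tangentPart (x : Eu n) v, (x : Eu n)⟫ = 0 := by
  rw [tangentPart, inner_sub_left, inner_smul_left, inner_self_sphere]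
  simp

theorem inner_tangentPart_of_tangent {n : ℕ} (x : Eu n) (v w : Eu n) (hw : ⟪w, x⟫ = 0) :
    ⟪tangentPart x v, w⟫ = ⟪v, w⟫ := by
  rw [tangentPart, inner_sub_left, inner_smul_left, real_inner_comm w x, hw]
  simp

theorem continuous_tangentPart_mollGrad {f : USphere (d + 1) → ℝ}
    (hf : Integrable f (sphereσ (d + 1))) (k : ℕ) :
    Continuous fun x : USphere (d + 1) => tangentPart (x : Eu (d + 1)) (mollGrad f k x) := by
  have := continuous_mollGrad hf k
  unfold tangentPart
  fun_prop

/-- Duality between the gradient of the mollification and the transported field. -/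
theorem integral_inner_mollGrad {f : USphere (d + 1) → ℝ} (hf : Integrable f (sphereσ (d + 1)))
    (k : ℕ) {X : USphere (d + 1) → Eu (d + 1)} (hX : Integrable X (sphereσ (d + 1)))
    (htan : ∀ x, ⟪X x, (x : Eu (d + 1))⟫ = 0) (hle : ∀ x, ‖X x‖ ≤ 1) :
    ∫ x, ⟪mollGrad f k x, X x⟫ ∂(sphereσ (d + 1)) =
      ∫ y, f y * sphereDiv (fun z => (-((zonalMass d (k + 2))⁻¹ * (k + 2) / (k + (d + 1)))) •
        transportField k X z) y ∂(sphereσ (d + 1)) := by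
  have hk : (k + (d + 1) : ℝ) ≠ 0 := by positivity
  -- The scalar is chosen to cancel the factor `-(k + (d + 1))` in `sphereDiv_transportField`; both
  -- sides then become the same double integral, up to Fubini.
  have hR : ∀ y : USphere (d + 1), f y * sphereDiv (fun z =>
      (-((zonalMass d (k + 2))⁻¹ * (k + 2) / (k + (d + 1)))) • transportField k X z) y =
      ∫ x, ((zonalMass d (k + 2))⁻¹ * (k + 2)) *
        ((1 + ⟪(x : Eu (d + 1)), (y : Eu (d + 1))⟫) ^ (k + 1) * (f y * ⟪X x, (y : Eu (d + 1))⟫)) ∂(sphereσ (d + 1)) := by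
    intro y
    rw [sphereDiv_const_smul ((contDiff_transportField hX k).differentiable (by simp) _),
      sphereDiv_transportField hX htan, integral_const_mul]
    have : ∀ x : USphere (d + 1), (1 + ⟪(x : Eu (d + 1)), (y : Eu (d + 1))⟫) ^ (k + 1) *
        (f y * ⟪X x, (y : Eu (d + 1))⟫) = f y *
        ((1 + ⟪(x : Eu (d + 1)), (y : Eu (d + 1))⟫) ^ (k + 1) * ⟪X x, (y : Eu (d + 1))⟫) :=
      fun x => by ring
    simp only [this]
    rw [integral_const_mul]
    push_cast
    field_simp
  have hL : ∀ x : USphere (d + 1), ⟪mollGrad f k x, X x⟫ =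
      ∫ y, ((zonalMass d (k + 2))⁻¹ * (k + 2)) *
        ((1 + ⟪(x : Eu (d + 1)), (y : Eu (d + 1))⟫) ^ (k + 1) * (f y * ⟪X x, (y : Eu (d + 1))⟫)) ∂(sphereσ (d + 1)) := by
    intro x
    have h := zonalInt_map (innerSL ℝ (X x)) (k + 1) (integrable_smul_coe hf) (x : Eu (d + 1))
    simp only [innerSL_apply_apply, inner_smul_right] at h
    rw [mollGrad, inner_smul_left, real_inner_comm, h, integral_const_mul]
    simp only [conj_trivial, zonalInt, smul_eq_mul]
    congr 2
    ext1 y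
    rw [real_inner_comm (y : Eu (d + 1)) (x : Eu (d + 1))]
  simp only [hR, hL]
  refine integral_integral_swap ?_
  refine Integrable.const_mul ?_ _
  have hb : Integrable (fun p : USphere (d + 1) × USphere (d + 1) => f p.2)
      ((sphereσ (d + 1)).prod (sphereσ (d + 1))) := hf.comp_snd _
  have hXm : AEStronglyMeasurable (fun p : USphere (d + 1) × USphere (d + 1) => X p.1)
      ((sphereσ (d + 1)).prod (sphereσ (d + 1))) := hX.aestronglyMeasurable.comp_fst
  have hm : AEStronglyMeasurable (fun p : USphere (d + 1) × USphere (d + 1) =>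
      (1 + ⟪(p.1 : Eu (d + 1)), (p.2 : Eu (d + 1))⟫) ^ (k + 1) * ⟪X p.1, (p.2 : Eu (d + 1))⟫)
      ((sphereσ (d + 1)).prod (sphereσ (d + 1))) := by
    refine AEStronglyMeasurable.mul ?_ ?_
    · exact Continuous.aestronglyMeasurable (by fun_prop)
    · exact hXm.inner (Continuous.aestronglyMeasurable (by fun_prop))
  refine (hb.bdd_mul (c := 2 ^ (k + 1)) hm ?_).congr ?_
  · filter_upwards with p
    rw [norm_mul, norm_pow, Real.norm_eq_abs, Real.norm_eq_abs]
    have h1 := abs_one_add_inner_le p.1 (p.2 : Eu (d + 1))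
    have h2 := (abs_real_inner_le_norm (X p.1) (p.2 : Eu (d + 1))).trans
      (mul_le_mul_of_nonneg_right (hle p.1) (norm_nonneg _))
    rw [norm_coe_sphere] at h1 h2
    calc _ ≤ (1 + 1) ^ (k + 1) * (1 * 1 : ℝ) := by gcongr
      _ = _ := by norm_num
  · filter_upwards with p
    ring

/-- The total variation of the mollification is at most that of the function. -/
theorem integral_norm_mollGrad_le (hd : 1 ≤ d) {f : USphere (d + 1) → ℝ} (hf : IsBV f) (k : ℕ) :
    ∫ x : USphere (d + 1), ‖tangentPart (x : Eu (d + 1)) (mollGrad f k x)‖ ∂(sphereσ (d + 1)) ≤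
      (totalVariation f).toReal := by
  set w : USphere (d + 1) → Eu (d + 1) :=
    fun x => tangentPart (x : Eu (d + 1)) (mollGrad f k x) with hw
  have hwc : Continuous w := continuous_tangentPart_mollGrad hf.integrable k
  -- The optimal dual field, equal to `0` where `w` vanishes. It is only measurable, but its
  -- transport is smooth and so may serve as a test field.
  set X : USphere (d + 1) → Eu (d + 1) := fun x => ‖w x‖⁻¹ • w x with hXdef
  have hle : ∀ x, ‖X x‖ ≤ 1 := fun x => by
    change ‖‖w x‖⁻¹ • w x‖ ≤ 1
    rw [norm_smul, norm_inv, norm_norm]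
    exact inv_mul_le_one
  have htan : ∀ x, ⟪X x, (x : Eu (d + 1))⟫ = 0 := fun x => by
    change ⟪‖w x‖⁻¹ • w x, (x : Eu (d + 1))⟫ = 0
    rw [inner_smul_left, hw, inner_tangentPart, mul_zero]
  have hXm : AEStronglyMeasurable X (sphereσ (d + 1)) :=
    (hwc.norm.measurable.inv.aestronglyMeasurable).smul hwc.aestronglyMeasurable
  have hX : Integrable X (sphereσ (d + 1)) :=
    Integrable.of_bound hXm 1 (ae_of_all _ hle)
  have h1 : ∀ x : USphere (d + 1), ‖w x‖ = ⟪mollGrad f k x, X x⟫ := by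
    intro x
    rw [← inner_tangentPart_of_tangent (x : Eu (d + 1)) _ _ (htan x)]
    change _ = ⟪w x, ‖w x‖⁻¹ • w x⟫
    rw [inner_smul_right, real_inner_self_eq_norm_sq]
    rcases eq_or_ne ‖w x‖ 0 with h | h
    · simp [h]
    · field_simp
  have h2 : ∫ x, ‖w x‖ ∂(sphereσ (d + 1)) = ∫ x, ⟪mollGrad f k x, X x⟫ ∂(sphereσ (d + 1)) := by
    exact integral_congr_ae (ae_of_all _ h1)
  rw [h2, integral_inner_mollGrad hf.integrable k hX htan hle]
  refine (ENNReal.ofReal_le_iff_le_toReal hf.finite_variation.ne).mp ?_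
  refine le_iSup₂_of_le _ ⟨(contDiff_transportField hX k).const_smul _, ?_, ?_⟩ le_rfl
  · intro x
    rw [inner_smul_left, inner_transportField hX, mul_zero]
  · intro x
    have hm := zonalMass_pos d (k + 2)
    have hd' : (1 : ℝ) ≤ d := by exact_mod_cast hd
    rw [norm_smul, norm_neg, Real.norm_of_nonneg (by positivity)]
    calc _ ≤ (zonalMass d (k + 2))⁻¹ * (k + 2) / (k + (d + 1)) * zonalMass d (k + 2) := by
          gcongr
          exact norm_transportField_le hX htan hle k x
      -- This ratio is at most one exactly because `1 ≤ d`.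
      _ = (k + 2) / (k + (d + 1)) := by field_simp
      _ ≤ 1 := by
          rw [div_le_one (by positivity)]
          linarith

end Mollifier

/-! ### The divergence theorem on the sphere -/

section Divergence

variable {n : ℕ}

theorem integral_fderiv_eq_zero {U : Eu n → Eu n} (hU : ContDiff ℝ 1 U)
    (hc : HasCompactSupport U) (v : Eu n) : ∫ z, fderiv ℝ U z v = 0 := by
  have hcont : Continuous fun z => fderiv ℝ U z v :=
    (hU.continuous_fderiv one_ne_zero).clm_apply continuous_const
  have hcs : HasCompactSupport fun z => fderiv ℝ U z v := hc.fderiv_apply (𝕜 := ℝ) v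
  have h := integral_smul_fderiv_eq_neg_fderiv_smul_of_integrable (μ := volume)
    (f := fun _ : Eu n => (1 : ℝ)) (g := U) (v := v) (by simp)
    (by simpa using hcont.integrable_of_hasCompactSupport hcs)
    (by simpa using hU.continuous.integrable_of_hasCompactSupport hc)
    (fun x _ => differentiableAt_const _) (fun x _ => hU.differentiable one_ne_zero x)
  simpa using h

theorem integral_trace_fderiv_eq_zero {U : Eu n → Eu n} (hU : ContDiff ℝ 1 U)
    (hc : HasCompactSupport U) :
    ∫ z, LinearMap.trace ℝ (Eu n) (fderiv ℝ U z : Eu n →ₗ[ℝ] Eu n) = 0 := by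
  set b := EuclideanSpace.basisFun (Fin n) ℝ
  have hint : ∀ i, Integrable fun z => fderiv ℝ U z (b i) := fun i =>
    ((hU.continuous_fderiv one_ne_zero).clm_apply
      continuous_const).integrable_of_hasCompactSupport (hc.fderiv_apply (𝕜 := ℝ) (b i))
  simp only [LinearMap.trace_eq_sum_inner _ b, ContinuousLinearMap.coe_coe]
  rw [integral_finsetSum _ fun i _ => (hint i).const_inner (b i)]
  refine Finset.sum_eq_zero fun i _ => ?_
  rw [integral_inner (hint i), integral_fderiv_eq_zero hU hc, inner_zero_right]

/-- Polar coordinates for a product of a radial function and a function of the direction. -/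
theorem integral_radial_mul (φ : ℝ → ℝ) (ψ : USphere (n + 1) → ℝ) (Ψ : Eu (n + 1) → ℝ)
    (hΨ : ∀ z : Eu (n + 1), ∀ x : USphere (n + 1), z ≠ 0 → (x : Eu (n + 1)) = ‖z‖⁻¹ • z →
      Ψ z = φ ‖z‖ * ψ x) :
    ∫ z, Ψ z = (∫ x, ψ x ∂(volume : Measure (Eu (n + 1))).toSphere) *
      ∫ r : Ioi (0 : ℝ), φ r ∂(Measure.volumeIoiPow (Module.finrank ℝ (Eu (n + 1)) - 1)) := by
  calc ∫ z, Ψ z = ∫ z : ({0}ᶜ : Set (Eu (n + 1))), Ψ z ∂((volume : Measure (Eu (n + 1))).comap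
        Subtype.val) := by
        rw [integral_subtype_comap (measurableSet_singleton _).compl Ψ, restrict_compl_singleton]
    _ = ∫ p, ψ p.1 * φ p.2 ∂((volume : Measure (Eu (n + 1))).toSphere.prod
          (Measure.volumeIoiPow (Module.finrank ℝ (Eu (n + 1)) - 1))) := by
        rw [← (Measure.measurePreserving_homeomorphUnitSphereProd
          (volume : Measure (Eu (n + 1)))).integral_comp (Homeomorph.measurableEmbedding _)]
        congr 1
        ext1 z
        rw [mul_comm, hΨ z (homeomorphUnitSphereProd (Eu (n + 1)) z).1 z.2
          (by simp)]
        simp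
    _ = _ := integral_prod_mul ψ fun r : Ioi (0 : ℝ) => φ r

theorem hasFDerivAt_norm_of_ne {z : Eu n} (hz : z ≠ 0) :
    HasFDerivAt (fun y : Eu n => ‖y‖) (‖z‖⁻¹ • innerSL ℝ z) z := by
  have h := (hasStrictFDerivAt_norm_sq z).hasFDerivAt.sqrt (by positivity)
  simp only [Real.sqrt_sq (norm_nonneg _)] at h
  refine h.congr_fderiv ?_
  ext v
  have : ‖z‖ ≠ 0 := norm_ne_zero_iff.mpr hz
  simp
  field_simp

/-- The derivative of `y ↦ ‖y‖⁻¹ • y` is `‖z‖⁻¹` times the projection to the tangent space, which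
produces the spherical divergence; the term with the derivative of `χ` pairs `Y x` with the normal
and vanishes by tangency. -/
theorem trace_fderiv_radial_smul {Y : Eu n → Eu n} (hY : Differentiable ℝ Y)
    (htan : ∀ x : USphere n, ⟪Y x, (x : Eu n)⟫ = 0) {χ : ℝ → ℝ} (hχ : Differentiable ℝ χ)
    {z : Eu n} (hz : z ≠ 0) (x : USphere n) (hx : (x : Eu n) = ‖z‖⁻¹ • z) :
    LinearMap.trace ℝ (Eu n)
      (fderiv ℝ (fun y : Eu n => χ ‖y‖ • Y (‖y‖⁻¹ • y)) z : Eu n →ₗ[ℝ] Eu n) =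
      χ ‖z‖ * ‖z‖⁻¹ * sphereDiv Y x := by
  have hr : ‖z‖ ≠ 0 := norm_ne_zero_iff.mpr hz
  have hzx : z = ‖z‖ • (x : Eu n) := by rw [hx, smul_smul, mul_inv_cancel₀ hr, one_smul]
  have hN := hasFDerivAt_norm_of_ne hz
  have hinv := (hasDerivAt_inv hr).comp_hasFDerivAt z hN
  have hP : HasFDerivAt (fun y : Eu n => ‖y‖⁻¹ • y) _ z := hinv.smul (hasFDerivAt_id z)
  have hYP : HasFDerivAt (fun y : Eu n => Y (‖y‖⁻¹ • y)) _ z :=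
    HasFDerivAt.comp z (hY (‖z‖⁻¹ • z)).hasFDerivAt hP
  have hU : HasFDerivAt (fun y : Eu n => χ ‖y‖ • Y (‖y‖⁻¹ • y)) _ z :=
    ((hχ ‖z‖).hasDerivAt.comp_hasFDerivAt z hN).smul hYP
  rw [hU.fderiv]
  rw [← hx]
  have e1 : ∀ D : Eu n →L[ℝ] Eu n, ∀ (c c' : ℝ) (φ φ' : Eu n →L[ℝ] ℝ) (v w : Eu n),
      LinearMap.trace ℝ (Eu n) ((c • (D.comp (c' • ContinuousLinearMap.id ℝ (Eu n) +
        φ.smulRight v)) + φ'.smulRight w : Eu n →L[ℝ] Eu n) : Eu n →ₗ[ℝ] Eu n) =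
      c * (c' * LinearMap.trace ℝ (Eu n) (D : Eu n →ₗ[ℝ] Eu n) + φ (D v)) + φ' w := by
    intro D c c' φ φ' v w
    have : (c • (D.comp (c' • ContinuousLinearMap.id ℝ (Eu n) + φ.smulRight v)) +
        φ'.smulRight w : Eu n →L[ℝ] Eu n) =
        (c * c') • D + c • φ.smulRight (D v) + φ'.smulRight w := by
      ext1 h
      simp [smul_smul]
    rw [this]
    simp only [ContinuousLinearMap.toLinearMap_add, ContinuousLinearMap.toLinearMap_smul,
      map_add, map_smul, trace_smulRight, smul_eq_mul]
    ring
  refine (e1 _ _ _ _ _ _ _).trans ?_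
  have h0 := htan x
  rw [sphereDiv]
  have hYz : ⟪z, Y (x : Eu n)⟫ = 0 := by
    rw [hzx, inner_smul_left, real_inner_comm, h0, mul_zero]
  have hDz : ⟪z, fderiv ℝ Y (x : Eu n) z⟫ =
      ‖z‖ ^ 2 * ⟪fderiv ℝ Y (x : Eu n) (x : Eu n), (x : Eu n)⟫ := by
    have : ∀ r : ℝ, ⟪r • (x : Eu n), fderiv ℝ Y (x : Eu n) (r • (x : Eu n))⟫ =
        r ^ 2 * ⟪fderiv ℝ Y (x : Eu n) (x : Eu n), (x : Eu n)⟫ := by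
      intro r
      rw [map_smul, inner_smul_left, inner_smul_right, real_inner_comm]
      simp only [conj_trivial]
      ring
    rw [← this, ← hzx]
  simp only [Function.comp_apply, _root_.smul_apply, innerSL_apply_apply, hYz, hDz, smul_eq_mul]
  field_simp
  ring

/-- The divergence theorem on the unit sphere. -/
theorem integral_sphereDiv_eq_zero {d : ℕ} {Y : Eu (d + 1) → Eu (d + 1)} (hY : ContDiff ℝ 1 Y)
    (htan : ∀ x : USphere (d + 1), ⟪Y x, (x : Eu (d + 1))⟫ = 0) :
    ∫ x, sphereDiv Y x ∂(sphereσ (d + 1)) = 0 := by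
  -- A bump supported in radii between `1` and `3`, so that the extension `U` vanishes near the
  -- origin and has compact support. The extra factor `r` in `χ` cancels the `‖z‖⁻¹` of
  -- `trace_fderiv_radial_smul`.
  let η : ContDiffBump (2 : ℝ) := ⟨1 / 2, 1, by norm_num, by norm_num⟩
  set χ : ℝ → ℝ := fun r => η r * r with hχ
  have hη : ContDiff ℝ 1 (fun r => η r) := η.contDiff
  have hχd : ContDiff ℝ 1 χ := hη.mul contDiff_id
  have hη0 : ∀ r : ℝ, r ∉ ball (2 : ℝ) 1 → η r = 0 := fun r hr => by
    rw [← Function.notMem_support, η.support_eq]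
    exact hr
  set U : Eu (d + 1) → Eu (d + 1) := fun y => χ ‖y‖ • Y (‖y‖⁻¹ • y) with hUdef
  have hU : ContDiff ℝ 1 U := by
    rw [contDiff_iff_contDiffAt]
    intro z
    rcases eq_or_ne z 0 with rfl | hz
    · have : U =ᶠ[𝓝 0] fun _ => 0 := by
        filter_upwards [ball_mem_nhds (0 : Eu (d + 1)) one_pos] with y hy
        rw [mem_ball_zero_iff] at hy
        simp only [hUdef, hχ]
        rw [hη0, zero_mul, zero_smul]
        rw [Real.ball_eq_Ioo, mem_Ioo]
        intro h
        linarith [h.1]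
      exact contDiffAt_const.congr_of_eventuallyEq this
    · have hn : ContDiffAt ℝ 1 (fun y : Eu (d + 1) => ‖y‖) z := contDiffAt_norm ℝ hz
      refine (hχd.contDiffAt.comp z hn).smul (hY.contDiffAt.comp z ?_)
      exact (hn.inv (norm_ne_zero_iff.mpr hz)).smul contDiffAt_id
  have hUc : HasCompactSupport U := by
    refine HasCompactSupport.intro (isCompact_closedBall (0 : Eu (d + 1)) 3) fun y hy => ?_
    rw [mem_closedBall_zero_iff, not_le] at hy
    simp only [hUdef, hχ]
    rw [hη0, zero_mul, zero_smul]
    rw [Real.ball_eq_Ioo, mem_Ioo]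
    intro h
    linarith [h.2]
  have h1 := integral_trace_fderiv_eq_zero hU hUc
  rw [integral_radial_mul (fun r => η r) (fun x => sphereDiv Y x)] at h1
  -- The radial factor is nonzero: the same polar formula with angular part `1` expresses a positive
  -- integral through it.
  · have h2 : ∫ z : Eu (d + 1), η ‖z‖ = _ :=
      integral_radial_mul (fun r => η r) (fun _ => 1) _ fun z x _ _ => (mul_one _).symm
    have h3 : 0 < ∫ z : Eu (d + 1), η ‖z‖ := by
      refine Continuous.integral_pos_of_hasCompactSupport_nonneg_nonzero
        (hη.continuous.comp continuous_norm) ?_ (fun z => η.nonneg)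
        (x := (2 : ℝ) • (EuclideanSpace.single 0 1 : Eu (d + 1))) ?_
      · refine HasCompactSupport.intro (isCompact_closedBall (0 : Eu (d + 1)) 3) fun y hy => ?_
        rw [mem_closedBall_zero_iff, not_le] at hy
        refine hη0 _ ?_
        rw [Real.ball_eq_Ioo, mem_Ioo]
        intro h
        linarith [h.2]
      · rw [norm_smul]
        simp only [Real.norm_ofNat, PiLp.norm_single, norm_one, mul_one]
        rw [η.one_of_mem_closedBall (mem_closedBall_self (by norm_num))]
        exact one_ne_zero
    rw [h2] at h3
    rw [sphereσ, integral_smul_measure]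
    rcases mul_eq_zero.mp h1 with h | h
    · rw [h, smul_zero]
    · rw [h, mul_zero] at h3
      exact absurd h3 (lt_irrefl _)
  · intro z x hz hx
    rw [trace_fderiv_radial_smul (hY.differentiable one_ne_zero) htan
      (hχd.differentiable one_ne_zero) hz x hx]
    have : ‖z‖ ≠ 0 := norm_ne_zero_iff.mpr hz
    simp only [hχ]
    field_simp

end Divergence

/-! ### Averaged differences -/

section AvgDiff

variable {d : ℕ}

/-- The mean of `|f (g x) - f (g y)|` over the orthogonal group. -/
def avgDiff (f : USphere (d + 1) → ℝ) (x y : USphere (d + 1)) : ℝ :=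
  ∫ g, |f (rot g x) - f (rot g y)| ∂(haarO (d + 1))

variable {f : USphere (d + 1) → ℝ}

theorem integrable_orbit (hf : Integrable f (sphereσ (d + 1))) (x : USphere (d + 1)) :
    Integrable (fun g => f (rot g x)) (haarO (d + 1)) :=
  (measurePreserving_orbit x).integrable_comp_of_integrable hf

theorem integrable_orbit_sub (hf : Integrable f (sphereσ (d + 1))) (x y : USphere (d + 1)) :
    Integrable (fun g => |f (rot g x) - f (rot g y)|) (haarO (d + 1)) :=
  ((integrable_orbit hf x).sub (integrable_orbit hf y)).abs

theorem integral_orbit (hf : AEStronglyMeasurable f (sphereσ (d + 1))) (x : USphere (d + 1)) :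
    ∫ g, f (rot g x) ∂(haarO (d + 1)) = ∫ y, f y ∂(sphereσ (d + 1)) := by
  rw [← (measurePreserving_orbit x).map_eq] at hf ⊢
  rw [integral_map (measurable_rot_left x).aemeasurable hf]

theorem avgDiff_nonneg (x y : USphere (d + 1)) : 0 ≤ avgDiff f x y :=
  integral_nonneg fun _ => abs_nonneg _

@[simp] theorem avgDiff_self (x : USphere (d + 1)) : avgDiff f x x = 0 := by
  simp [avgDiff]

theorem avgDiff_triangle (hf : Integrable f (sphereσ (d + 1))) (x y z : USphere (d + 1)) :
    avgDiff f x z ≤ avgDiff f x y + avgDiff f y z := by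
  rw [avgDiff, avgDiff, avgDiff,
    ← integral_add (integrable_orbit_sub hf x y) (integrable_orbit_sub hf y z)]
  exact integral_mono (integrable_orbit_sub hf x z)
    ((integrable_orbit_sub hf x y).add (integrable_orbit_sub hf y z))
    fun g => abs_sub_le _ _ _

theorem avgDiff_rot (k : OGroup (d + 1)) (x y : USphere (d + 1)) :
    avgDiff f (rot k x) (rot k y) = avgDiff f x y :=
  integral_mul_right_eq_self (μ := haarO (d + 1)) (fun g => |f (rot g x) - f (rot g y)|) k

/-- Pairs of points at equal distance are congruent, and right invariance of Haar measure absorbs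
the congruence. -/
theorem avgDiff_eq_of_inner_eq {x y x' y' : USphere (d + 1)}
    (h : ⟪(x : Eu (d + 1)), (y : Eu (d + 1))⟫ = ⟪(x' : Eu (d + 1)), (y' : Eu (d + 1))⟫) :
    avgDiff f x y = avgDiff f x' y' := by
  obtain ⟨k, hx, hy⟩ := exists_oGroup_pair (by simp) (by simp) h
  have hx' : rot k x = x' := Subtype.ext hx
  have hy' : rot k y = y' := Subtype.ext hy
  rw [← hx', ← hy', avgDiff_rot]

/-- Stability in `L¹`, uniform in the two points: each orbit map sends Haar measure to the surface
measure, so each endpoint costs one `L¹` distance. -/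
theorem avgDiff_le_add {h : USphere (d + 1) → ℝ} (hf : Integrable f (sphereσ (d + 1)))
    (hh : Integrable h (sphereσ (d + 1))) (x y : USphere (d + 1)) :
    avgDiff f x y ≤ avgDiff h x y + 2 * ∫ z, |f z - h z| ∂(sphereσ (d + 1)) := by
  have hfh : Integrable (fun z => |f z - h z|) (sphereσ (d + 1)) := (hf.sub hh).abs
  have e : ∀ x, ∫ z, |f z - h z| ∂(sphereσ (d + 1)) =
      ∫ g, |f (rot g x) - h (rot g x)| ∂(haarO (d + 1)) := fun x =>
    (integral_orbit hfh.aestronglyMeasurable x).symm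
  have ix := integrable_orbit hfh x
  have iy := integrable_orbit hfh y
  have ih := integrable_orbit_sub hh x y
  rw [two_mul]
  nth_rewrite 1 [e x]
  rw [e y, avgDiff, avgDiff, ← integral_add ix iy]
  refine le_of_le_of_eq ?_ (integral_add ih (ix.add iy))
  refine integral_mono (integrable_orbit_sub hf x y) (ih.add (ix.add iy)) fun g => ?_
  change |f (rot g x) - f (rot g y)| ≤ |h (rot g x) - h (rot g y)| +
    (|f (rot g x) - h (rot g x)| + |f (rot g y) - h (rot g y)|)
  have h1 := abs_sub_le (f (rot g x)) (h (rot g x)) (f (rot g y))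
  have h2 := abs_sub_le (h (rot g x)) (h (rot g y)) (f (rot g y))
  rw [abs_sub_comm (h (rot g y))] at h2
  linarith

/-! ### Great circles -/

/-- An orthonormal pair of vectors. -/
structure OrthoPair (n : ℕ) where
  u : Eu n
  v : Eu n
  norm_u : ‖u‖ = 1
  norm_v : ‖v‖ = 1
  inner_uv : ⟪u, v⟫ = 0

namespace OrthoPair

variable {n : ℕ} (P : OrthoPair n)

theorem inner_uu : ⟪P.u, P.u⟫ = 1 := by rw [real_inner_self_eq_norm_sq, P.norm_u]; norm_num

theorem inner_vv : ⟪P.v, P.v⟫ = 1 := by rw [real_inner_self_eq_norm_sq, P.norm_v]; norm_num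

theorem inner_vu : ⟪P.v, P.u⟫ = 0 := by rw [real_inner_comm, P.inner_uv]

theorem inner_arc (s t : ℝ) : ⟪Real.cos s • P.u + Real.sin s • P.v,
    Real.cos t • P.u + Real.sin t • P.v⟫ = Real.cos (s - t) := by
  simp only [inner_add_left, inner_add_right, inner_smul_left, inner_smul_right, P.inner_uu,
    P.inner_vv, P.inner_uv, P.inner_vu, conj_trivial, Real.cos_sub]
  ring

/-- The great circle through an orthonormal pair. -/
def arc (t : ℝ) : USphere n :=
  ⟨Real.cos t • P.u + Real.sin t • P.v, by
    rw [mem_sphere_zero_iff_norm, ← sq_eq_sq₀ (norm_nonneg _) zero_le_one,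
      ← real_inner_self_eq_norm_sq, P.inner_arc]
    simp⟩

theorem coe_arc (t : ℝ) : (P.arc t : Eu n) = Real.cos t • P.u + Real.sin t • P.v := rfl

theorem coe_arc_zero : (P.arc 0 : Eu n) = P.u := by simp [coe_arc]

theorem inner_coe_arc (s t : ℝ) : ⟪(P.arc s : Eu n), (P.arc t : Eu n)⟫ = Real.cos (s - t) :=
  P.inner_arc s t

theorem norm_arc_sub_le (t : ℝ) : ‖(P.arc t : Eu n) - P.arc 0‖ ≤ |t| := by
  rw [← abs_norm, ← sq_le_sq, ← real_inner_self_eq_norm_sq]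
  simp only [inner_sub_left, inner_sub_right, inner_coe_arc, sub_self, sub_zero, zero_sub,
    Real.cos_neg, Real.cos_zero]
  linarith [Real.one_sub_sq_div_two_le_cos (x := t)]

theorem hasDerivAt_arc_zero : HasDerivAt (fun t => (P.arc t : Eu n)) P.v 0 := by
  have h : HasDerivAt (fun t => (P.arc t : Eu n)) (-Real.sin 0 • P.u + Real.cos 0 • P.v) 0 :=
    ((Real.hasDerivAt_cos 0).smul_const P.u).add ((Real.hasDerivAt_sin 0).smul_const P.v)
  refine h.congr_deriv ?_
  simp

/-- The rotation by the angle `t` in the plane of an orthonormal pair. -/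
theorem exists_rotation (t : ℝ) : ∃ R : OGroup n, rot R (P.arc 0) = P.arc t ∧
    ∀ y : USphere n, Real.cos t ≤ ⟪(y : Eu n), (rot R y : Eu n)⟫ := by
  set c := Real.cos t
  set s := Real.sin t
  have hcs : c ^ 2 + s ^ 2 = 1 := Real.cos_sq_add_sin_sq t
  -- Rotation in the plane of `u` and `v`, identity on the orthogonal complement.
  let L : Eu n →ₗ[ℝ] Eu n := LinearMap.id +
    (innerSL ℝ P.u : Eu n →ₗ[ℝ] ℝ).smulRight ((c - 1) • P.u + s • P.v) +
    (innerSL ℝ P.v : Eu n →ₗ[ℝ] ℝ).smulRight ((c - 1) • P.v - s • P.u)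
  have hL : ∀ y, L y = y + ⟪P.u, y⟫ • ((c - 1) • P.u + s • P.v) +
      ⟪P.v, y⟫ • ((c - 1) • P.v - s • P.u) := fun y => rfl
  have hnorm : ∀ y, ‖L y‖ = ‖y‖ := by
    intro y
    rw [← sq_eq_sq₀ (norm_nonneg _) (norm_nonneg _), ← real_inner_self_eq_norm_sq,
      ← real_inner_self_eq_norm_sq, hL]
    simp only [inner_add_left, inner_add_right, inner_sub_left, inner_sub_right, inner_smul_left,
      inner_smul_right, P.inner_uu, P.inner_vv, P.inner_uv, P.inner_vu, conj_trivial,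
      real_inner_comm P.u y, real_inner_comm P.v y]
    linear_combination (⟪P.u, y⟫ ^ 2 + ⟪P.v, y⟫ ^ 2) * hcs
  let I : Eu n ≃ₗᵢ[ℝ] Eu n := LinearIsometry.toLinearIsometryEquiv ⟨L, hnorm⟩ rfl
  refine ⟨Unitary.linearIsometryEquiv.symm I, ?_, ?_⟩
  · refine Subtype.ext ?_
    change L (P.arc 0) = P.arc t
    rw [coe_arc_zero, hL, P.inner_uu, P.inner_vu, coe_arc]
    module
  · intro y
    change c ≤ ⟪(y : Eu n), L y⟫
    rw [hL]
    simp only [inner_add_right, inner_sub_right, inner_smul_right, inner_self_sphere,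
      real_inner_comm P.u (y : Eu n), real_inner_comm P.v (y : Eu n)]
    -- Bessel's inequality. It suffices because `⟪y, L y⟫ = 1 + (c - 1) * (⟪u, y⟫ ^ 2 + ⟪v, y⟫ ^
    -- 2)`.
    have hb : ⟪P.u, (y : Eu n)⟫ ^ 2 + ⟪P.v, (y : Eu n)⟫ ^ 2 ≤ 1 := by
      have h0 : 0 ≤ ‖(y : Eu n) - ⟪P.u, (y : Eu n)⟫ • P.u - ⟪P.v, (y : Eu n)⟫ • P.v‖ ^ 2 := by
        positivity
      rw [← real_inner_self_eq_norm_sq] at h0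
      simp only [inner_sub_left, inner_sub_right, inner_smul_left, inner_smul_right, P.inner_uu,
        P.inner_vv, P.inner_uv, P.inner_vu, conj_trivial, inner_self_sphere,
        real_inner_comm P.u (y : Eu n), real_inner_comm P.v (y : Eu n)] at h0
      nlinarith
    have hc1 : c ≤ 1 := Real.cos_le_one t
    nlinarith

end OrthoPair

theorem exists_orthoPair (hd : 1 ≤ d) : Nonempty (OrthoPair (d + 1)) := by
  refine ⟨⟨EuclideanSpace.single 0 1, EuclideanSpace.single (Fin.last d) 1, by simp, by simp, ?_⟩⟩
  rw [EuclideanSpace.inner_single_left]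
  have : (0 : Fin (d + 1)) ≠ Fin.last d := by
    intro h
    have := congrArg Fin.val h
    simp at this
    omega
  simp [this]

theorem cos_geoDist {n : ℕ} (x y : USphere n) :
    Real.cos (geoDist x y) = ⟪(x : Eu n), (y : Eu n)⟫ := by
  have h := abs_real_inner_le_norm (x : Eu n) y
  rw [norm_coe_sphere, norm_coe_sphere, one_mul] at h
  exact Real.cos_arccos (abs_le.mp h).1 (abs_le.mp h).2

theorem avgDiff_eq_arc (P : OrthoPair (d + 1)) (x y : USphere (d + 1)) :
    avgDiff f x y = avgDiff f (P.arc 0) (P.arc (geoDist x y)) :=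
  avgDiff_eq_of_inner_eq (by rw [P.inner_coe_arc, zero_sub, Real.cos_neg, cos_geoDist])

theorem avgDiff_arc_add (hf : Integrable f (sphereσ (d + 1))) (P : OrthoPair (d + 1)) (s t : ℝ) :
    avgDiff f (P.arc 0) (P.arc (s + t)) ≤
      avgDiff f (P.arc 0) (P.arc s) + avgDiff f (P.arc 0) (P.arc t) := by
  have : avgDiff f (P.arc s) (P.arc (s + t)) = avgDiff f (P.arc 0) (P.arc t) :=
    avgDiff_eq_of_inner_eq (by rw [P.inner_coe_arc, P.inner_coe_arc]; congr 1; ring)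
  rw [← this]
  exact avgDiff_triangle hf _ _ _

theorem avgDiff_arc_nat_mul (hf : Integrable f (sphereσ (d + 1))) (P : OrthoPair (d + 1)) (t : ℝ)
    (j : ℕ) : avgDiff f (P.arc 0) (P.arc (j * t)) ≤ j * avgDiff f (P.arc 0) (P.arc t) := by
  induction j with
  | zero => simp
  | succ j ih =>
    have := avgDiff_arc_add hf P (j * t) t
    push_cast
    rw [add_mul, one_mul, add_mul, one_mul]
    linarith

/-! ### Averaging over directions -/

theorem davilaConst_eq (e e' : USphere d) : davilaConst e = davilaConst e' := by
  obtain ⟨g, rfl⟩ := exists_rot_eq e e'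
  have hemb : MeasurableEmbedding (rot g) :=
    MeasurableEquiv.measurableEmbedding
      { toFun := rot g, invFun := rot g⁻¹, left_inv := rot_inv_rot g, right_inv := rot_rot_inv g,
        measurable_toFun := measurable_rot_right g,
        measurable_invFun := measurable_rot_right g⁻¹ }
  rw [davilaConst, davilaConst, ← (measurePreserving_rot g).integral_comp hemb
    (fun ξ => |⟪(rot g e : Eu d), (ξ : Eu d)⟫|)]
  simp only [coe_rot, inner_oGroup]

theorem davilaConst_nonneg (e : USphere d) : 0 ≤ davilaConst e :=
  integral_nonneg fun _ => abs_nonneg _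

theorem integral_abs_inner (e : USphere d) (a : Eu d) :
    ∫ ξ : USphere d, |⟪a, (ξ : Eu d)⟫| ∂(sphereσ d) = davilaConst e * ‖a‖ := by
  rcases eq_or_ne a 0 with rfl | ha
  · simp
  · have hr : ‖a‖ ≠ 0 := norm_ne_zero_iff.mpr ha
    let a' : USphere d := ⟨‖a‖⁻¹ • a, by
      rw [mem_sphere_zero_iff_norm, norm_smul, norm_inv, norm_norm, inv_mul_cancel₀ hr]⟩
    have haa : a = ‖a‖ • (a' : Eu d) := by
      change a = ‖a‖ • ‖a‖⁻¹ • a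
      rw [smul_smul, mul_inv_cancel₀ hr, one_smul]
    rw [davilaConst_eq e a', davilaConst, mul_comm, ← integral_const_mul]
    congr 1
    ext1 ξ
    nth_rewrite 1 [haa]
    rw [inner_smul_left, abs_mul]
    simp

/-- For random `g`, the point `g u` is uniform on the sphere and, given it, `g v` is a uniform unit
tangent vector there. Concretely, right multiplication by a map fixing `u` replaces `v` by any unit
vector orthogonal to `u`; averaging over these, identified with the sphere of `ℝᵈ`, gives the
constant. -/
theorem integral_abs_inner_rot (hd : 1 ≤ d) (e : USphere d) (P : OrthoPair (d + 1))
    {w : USphere (d + 1) → Eu (d + 1)} (hw : Continuous w)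
    (htan : ∀ x, ⟪w x, (x : Eu (d + 1))⟫ = 0) :
    ∫ g : OGroup (d + 1), |⟪w (rot g (P.arc 0)), (g : Eu (d + 1) →L[ℝ] Eu (d + 1)) P.v⟫|
      ∂(haarO (d + 1)) = davilaConst e * ∫ x, ‖w x‖ ∂(sphereσ (d + 1)) := by
  have hprob := isProbabilityMeasure_sphereσ hd
  have hfact : Fact (Module.finrank ℝ (Eu (d + 1)) = d + 1) := ⟨by simp⟩
  have hu : P.u ≠ 0 := by
    intro h
    have := P.norm_u
    rw [h, norm_zero] at this
    exact zero_ne_one this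
  let b := OrthonormalBasis.fromOrthogonalSpanSingleton (𝕜 := ℝ) d hu
  let J : Eu d → Eu (d + 1) := fun ξ => (b.repr.symm ξ : Eu (d + 1))
  have hJc : Continuous J := continuous_subtype_val.comp b.repr.symm.continuous
  have hJn : ∀ ξ, ‖J ξ‖ = ‖ξ‖ := fun ξ => by
    change ‖b.repr.symm ξ‖ = _
    exact b.repr.symm.norm_map ξ
  have hJu : ∀ ξ, ⟪P.u, J ξ⟫ = 0 := fun ξ =>
    Submodule.mem_orthogonal_singleton_iff_inner_right.mp (b.repr.symm ξ).2
  have hcont : Continuous fun p : USphere d × OGroup (d + 1) =>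
      |⟪w (rot p.2 (P.arc 0)), (p.2 : Eu (d + 1) →L[ℝ] Eu (d + 1)) (J p.1)⟫| := by
    have h1 : Continuous fun p : USphere d × OGroup (d + 1) => rot p.2 (P.arc 0) :=
      continuous_rot.comp (continuous_snd.prodMk continuous_const)
    have h2 : Continuous fun p : USphere d × OGroup (d + 1) =>
        (p.2 : Eu (d + 1) →L[ℝ] Eu (d + 1)) (J p.1) :=
      (continuous_subtype_val.comp continuous_snd).clm_apply
        (hJc.comp (continuous_subtype_val.comp continuous_fst))
    exact ((hw.comp h1).inner h2).abs
  have hconst : ∀ ξ : USphere d,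
      ∫ g : OGroup (d + 1), |⟪w (rot g (P.arc 0)), (g : Eu (d + 1) →L[ℝ] Eu (d + 1)) P.v⟫|
        ∂(haarO (d + 1)) =
      ∫ g : OGroup (d + 1), |⟪w (rot g (P.arc 0)), (g : Eu (d + 1) →L[ℝ] Eu (d + 1)) (J ξ)⟫|
        ∂(haarO (d + 1)) := by
    intro ξ
    obtain ⟨k, hk1, hk2⟩ := exists_oGroup_pair (a := P.u) (b := P.v) (a' := P.u) (b' := J ξ) rfl
      (by rw [P.norm_v, hJn, norm_coe_sphere]) (by rw [P.inner_uv, hJu])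
    rw [← integral_mul_right_eq_self (μ := haarO (d + 1)) _ k]
    congr 1
    ext1 g
    have e1 : rot (g * k) (P.arc 0) = rot g (P.arc 0) := by
      refine Subtype.ext ?_
      rw [rot_mul, coe_rot, coe_rot, coe_rot, P.coe_arc_zero, hk1]
    rw [e1]
    change |⟪_, (g : Eu (d + 1) →L[ℝ] Eu (d + 1)) ((k : Eu (d + 1) →L[ℝ] Eu (d + 1)) P.v)⟫| = _
    rw [hk2]
  have hinner : ∀ g : OGroup (d + 1),
      ∫ ξ : USphere d, |⟪w (rot g (P.arc 0)), (g : Eu (d + 1) →L[ℝ] Eu (d + 1)) (J ξ)⟫|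
        ∂(sphereσ d) = davilaConst e * ‖w (rot g (P.arc 0))‖ := by
    intro g
    set z : Eu (d + 1) := ((g⁻¹ : OGroup (d + 1)) : Eu (d + 1) →L[ℝ] Eu (d + 1))
      (w (rot g (P.arc 0))) with hz
    have hgz : (g : Eu (d + 1) →L[ℝ] Eu (d + 1)) z = w (rot g (P.arc 0)) := by
      have : ((g * g⁻¹ : OGroup (d + 1)) : Eu (d + 1) →L[ℝ] Eu (d + 1))
        (w (rot g (P.arc 0))) = w (rot g (P.arc 0)) := by rw [mul_inv_cancel]; rfl
      exact this
    have hzu : z ∈ (ℝ ∙ P.u)ᗮ := by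
      rw [Submodule.mem_orthogonal_singleton_iff_inner_right, ← inner_oGroup g, hgz,
        ← P.coe_arc_zero, ← coe_rot, real_inner_comm]
      exact htan _
    have hin : ∀ ξ : Eu d, ⟪w (rot g (P.arc 0)), (g : Eu (d + 1) →L[ℝ] Eu (d + 1)) (J ξ)⟫ =
        ⟪b.repr ⟨z, hzu⟩, ξ⟫ := by
      intro ξ
      rw [← hgz, inner_oGroup, ← b.repr.symm.inner_map_map, b.repr.symm_apply_apply]
      rfl
    simp only [hin]
    rw [integral_abs_inner e, b.repr.norm_map]
    congr 1
    rw [← hgz, norm_oGroup]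
    rfl
  have hswap := integral_integral_swap (μ := sphereσ d) (ν := haarO (d + 1))
    (f := fun ξ g => |⟪w (rot g (P.arc 0)), (g : Eu (d + 1) →L[ℝ] Eu (d + 1)) (J ξ)⟫|)
    (hcont.integrable_of_hasCompactSupport (HasCompactSupport.of_compactSpace _))
  simp only [hinner, ← hconst, integral_const, probReal_univ, one_smul] at hswap
  rw [hswap, integral_const_mul,
    integral_orbit (f := fun x => ‖w x‖) hw.norm.aestronglyMeasurable]

end AvgDiff

/-! ### Difference quotients of the mollifications -/

section Asymptotics

variable {d : ℕ} {f : USphere (d + 1) → ℝ}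

/-- The total variation of the mollification. -/
def mollVar (f : USphere (d + 1) → ℝ) (k : ℕ) : ℝ :=
  ∫ x : USphere (d + 1), ‖tangentPart (x : Eu (d + 1)) (mollGrad f k x)‖ ∂(sphereσ (d + 1))

theorem continuous_moll (hf : Integrable f (sphereσ (d + 1))) (k : ℕ) :
    Continuous fun x : USphere (d + 1) => moll f k x :=
  (contDiff_moll hf k).continuous.comp continuous_subtype_val

theorem integrable_of_continuous {F : Type} [NormedAddCommGroup F] {h : USphere (d + 1) → F}
    (hh : Continuous h) : Integrable h (sphereσ (d + 1)) :=
  hh.integrable_of_hasCompactSupport (HasCompactSupport.of_compactSpace _)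

theorem exists_lipschitz_moll (hf : Integrable f (sphereσ (d + 1))) (k : ℕ) :
    ∃ C : ℝ, 0 ≤ C ∧ ∀ x y : USphere (d + 1),
      |moll f k x - moll f k y| ≤ C * ‖(x : Eu (d + 1)) - y‖ := by
  obtain ⟨C, hC⟩ := (isCompact_closedBall (0 : Eu (d + 1)) 1).exists_bound_of_continuousOn
    (contDiff_mollGrad hf k).continuous.continuousOn
  refine ⟨C, (norm_nonneg _).trans (hC 0 (by simp)), fun x y => ?_⟩
  refine (convex_closedBall (0 : Eu (d + 1)) 1).norm_image_sub_le_of_norm_hasFDerivWithin_le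
    (fun z _ => (hasFDerivAt_moll hf k z).hasFDerivWithinAt) (fun z hz => ?_) ?_ ?_
  · rw [innerSL_apply_norm]
    exact hC z hz
  · simp
  · simp

/-- For each `g` the quotient tends to the absolute directional derivative along `g v`. The
Lipschitz bound dominates, and averaging over `g` is `integral_abs_inner_rot`. -/
theorem tendsto_avgDiff_moll (hd : 1 ≤ d) (e : USphere d) (P : OrthoPair (d + 1))
    (hf : Integrable f (sphereσ (d + 1))) (k : ℕ) :
    Tendsto (fun t => avgDiff (fun x => moll f k x) (P.arc 0) (P.arc t) / t) (𝓝[>] 0)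
      (𝓝 (davilaConst e * mollVar f k)) := by
  obtain ⟨C, hC0, hC⟩ := exists_lipschitz_moll hf k
  rw [mollVar, ← integral_abs_inner_rot hd e P (continuous_tangentPart_mollGrad hf k)
    fun x => inner_tangentPart x _]
  simp only [avgDiff, ← integral_div]
  have hcr : ∀ t, Continuous fun g : OGroup (d + 1) => moll f k (rot g (P.arc t)) := fun t =>
    (continuous_moll hf k).comp (continuous_rot.comp (continuous_id.prodMk continuous_const))
  refine tendsto_integral_filter_of_dominated_convergence (fun _ => C) ?_ ?_
    (integrable_const C) ?_
  · filter_upwards with t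
    exact (((hcr 0).sub (hcr t)).abs.div_const t).aestronglyMeasurable
  · filter_upwards [self_mem_nhdsWithin] with t ht
    have ht' : 0 < t := ht
    filter_upwards with g
    rw [Real.norm_of_nonneg (by positivity), div_le_iff₀ ht']
    refine (hC _ _).trans ?_
    gcongr
    rw [coe_rot, coe_rot, ← map_sub, norm_oGroup, norm_sub_rev]
    exact (P.norm_arc_sub_le t).trans (le_of_eq (abs_of_pos ht'))
  · filter_upwards with g
    have h1 : HasDerivAt (fun t => (g : Eu (d + 1) →L[ℝ] Eu (d + 1)) (P.arc t))
        ((g : Eu (d + 1) →L[ℝ] Eu (d + 1)) P.v) 0 :=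
      (g : Eu (d + 1) →L[ℝ] Eu (d + 1)).hasFDerivAt.comp_hasDerivAt 0 P.hasDerivAt_arc_zero
    have h2 : HasDerivAt (fun t => moll f k (rot g (P.arc t)))
        (⟪mollGrad f k (rot g (P.arc 0)), (g : Eu (d + 1) →L[ℝ] Eu (d + 1)) P.v⟫) 0 :=
      HasFDerivAt.comp_hasDerivAt (f := fun t => (g : Eu (d + 1) →L[ℝ] Eu (d + 1)) (P.arc t)) 0
        (hasFDerivAt_moll hf k (rot g (P.arc 0))) h1
    have horth : ⟪(g : Eu (d + 1) →L[ℝ] Eu (d + 1)) P.v, (rot g (P.arc 0) : Eu (d + 1))⟫ = 0 := by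
      rw [coe_rot, inner_oGroup, P.coe_arc_zero, P.inner_vu]
    rw [inner_tangentPart_of_tangent _ _ _ horth]
    have h3 := (hasDerivAt_iff_tendsto_slope.mp h2).mono_left
      (nhdsWithin_mono (0 : ℝ) fun t (ht : 0 < t) => ht.ne')
    refine h3.abs.congr' ?_
    filter_upwards [self_mem_nhdsWithin] with t ht
    have ht' : 0 < t := ht
    rw [slope_def_field, sub_zero, abs_div, abs_of_pos ht', abs_sub_comm]

/-- Subadditivity bounds the value at `θ` by `j + 1` times the value at `θ / (j + 1)`; then `j`
tends to infinity. -/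
theorem avgDiff_moll_le (hd : 1 ≤ d) (e : USphere d) (P : OrthoPair (d + 1))
    (hf : Integrable f (sphereσ (d + 1))) (k : ℕ) {θ : ℝ} (hθ : 0 < θ) :
    avgDiff (fun x => moll f k x) (P.arc 0) (P.arc θ) ≤ θ * (davilaConst e * mollVar f k) := by
  have hlim : Tendsto (fun j : ℕ => θ / (j + 1 : ℝ)) atTop (𝓝[>] 0) := by
    refine tendsto_nhdsWithin_iff.mpr ⟨?_, Eventually.of_forall fun j => ?_⟩
    · simpa [div_eq_mul_inv] using (tendsto_one_div_add_atTop_nhds_zero_nat (𝕜 := ℝ)).const_mul θ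
    · exact mem_Ioi.mpr (by positivity)
  have h := ((tendsto_avgDiff_moll hd e P hf k).comp hlim).const_mul θ
  refine ge_of_tendsto' h fun j => ?_
  have hj : (0 : ℝ) < j + 1 := by positivity
  have h1 := avgDiff_arc_nat_mul (integrable_of_continuous (continuous_moll hf k)) P
    (θ / (j + 1 : ℝ)) (j + 1)
  have h2 : ((j + 1 : ℕ) : ℝ) * (θ / (j + 1 : ℝ)) = θ := by
    push_cast
    field_simp
  rw [h2] at h1
  refine h1.trans (le_of_eq ?_)
  simp only [Function.comp_apply]
  push_cast
  field_simp

/-! ### Mollification as an average over the orthogonal group -/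

theorem moll_rot (g : OGroup (d + 1)) (k : ℕ) (x : USphere (d + 1)) :
    moll f k (rot g x) = (zonalMass d (k + 2))⁻¹ *
      ∫ y : USphere (d + 1), (1 + ⟪(y : Eu (d + 1)), (x : Eu (d + 1))⟫) ^ (k + 2) * f (rot g y)
        ∂(sphereσ (d + 1)) := by
  rw [moll, coe_rot, zonalInt_rot]
  rfl

theorem integrable_action (hf : Integrable f (sphereσ (d + 1))) :
    Integrable (fun p : OGroup (d + 1) × USphere (d + 1) => f (rot p.1 p.2))
      ((haarO (d + 1)).prod (sphereσ (d + 1))) :=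
  (measurePreserving_action d).integrable_comp_of_integrable hf

/-- The absolute value moves inside the average because the kernel is nonnegative on the sphere;
Fubini does the rest. -/
theorem integral_abs_zonal_le (m : ℕ) (p : USphere (d + 1))
    {a : OGroup (d + 1) × USphere (d + 1) → ℝ}
    (ha : Integrable a ((haarO (d + 1)).prod (sphereσ (d + 1)))) {c : ℝ} (hc : 0 ≤ c) :
    ∫ g, |c * ∫ y : USphere (d + 1), (1 + ⟪(y : Eu (d + 1)), (p : Eu (d + 1))⟫) ^ m * a (g, y)
        ∂(sphereσ (d + 1))| ∂(haarO (d + 1)) ≤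
      c * ∫ y : USphere (d + 1), (1 + ⟪(y : Eu (d + 1)), (p : Eu (d + 1))⟫) ^ m *
        (∫ g, |a (g, y)| ∂(haarO (d + 1))) ∂(sphereσ (d + 1)) := by
  have hint : Integrable (fun q : OGroup (d + 1) × USphere (d + 1) =>
      (1 + ⟪(q.2 : Eu (d + 1)), (p : Eu (d + 1))⟫) ^ m * |a q|)
      ((haarO (d + 1)).prod (sphereσ (d + 1))) := by
    refine ha.abs.bdd_mul (c := 2 ^ m) ?_ ?_
    · exact ((continuous_zonalKernel m (p : Eu (d + 1))).comp
        continuous_snd).aestronglyMeasurable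
    · filter_upwards with q
      rw [norm_pow, Real.norm_eq_abs]
      refine pow_le_pow_left₀ (abs_nonneg _) ?_ m
      have := abs_one_add_inner_le q.2 (p : Eu (d + 1))
      rw [norm_coe_sphere] at this
      linarith
  have hswap := integral_integral_swap (f := fun (g : OGroup (d + 1)) (y : USphere (d + 1)) =>
      (1 + ⟪(y : Eu (d + 1)), (p : Eu (d + 1))⟫) ^ m * |a (g, y)|) hint
  simp only [integral_const_mul] at hswap
  rw [← hswap, ← integral_const_mul]
  refine integral_mono_of_nonneg (ae_of_all _ fun _ => abs_nonneg _)
    (hint.integral_prod_left.const_mul c) (ae_of_all _ fun g => ?_)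
  simp only [abs_mul, abs_of_nonneg hc]
  refine mul_le_mul_of_nonneg_left ?_ hc
  refine abs_integral_le_integral_abs.trans (le_of_eq ?_)
  congr 1
  ext1 y
  rw [abs_mul, abs_of_nonneg (pow_nonneg (one_add_inner_nonneg y p) m)]

/-- Let `R` rotate `P.arc 0` to `P.arc θ` in their plane. The difference of the mollification at
these points is the kernel average of the differences of `f` between `y` and `R y`, and `R` moves no
point by more than `θ`. -/
theorem avgDiff_moll_le_of_le (P : OrthoPair (d + 1)) (hf : Integrable f (sphereσ (d + 1)))
    (k : ℕ) {S : ℝ} (hS : ∀ t, 0 < t → t ≤ Real.pi → avgDiff f (P.arc 0) (P.arc t) ≤ S * t)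
    {θ : ℝ} (hθ : 0 ≤ θ) (hθπ : θ ≤ Real.pi) :
    avgDiff (fun x => moll f k x) (P.arc 0) (P.arc θ) ≤ S * θ := by
  have hS0 : 0 ≤ S := by
    have := (avgDiff_nonneg _ _).trans (hS Real.pi Real.pi_pos le_rfl)
    exact nonneg_of_mul_nonneg_left this Real.pi_pos
  obtain ⟨R, hR0, hR⟩ := P.exists_rotation θ
  have hM := zonalMass_pos d (k + 2)
  have hRy : ∀ y : USphere (d + 1), avgDiff f y (rot R y) ≤ S * θ := by
    intro y
    rw [avgDiff_eq_arc P]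
    have hle : geoDist y (rot R y) ≤ θ := by
      rw [geoDist, ← Real.arccos_cos hθ hθπ]
      exact Real.arccos_le_arccos (hR y)
    have h0 : 0 ≤ geoDist y (rot R y) := Real.arccos_nonneg _
    rcases h0.eq_or_lt with h | h
    · rw [← h, avgDiff_self]
      positivity
    · exact (hS _ h (Real.arccos_le_pi _)).trans (mul_le_mul_of_nonneg_left hle hS0)
  have ha : Integrable (fun q : OGroup (d + 1) × USphere (d + 1) =>
      f (rot q.1 q.2) - f (rot q.1 (rot R q.2))) ((haarO (d + 1)).prod (sphereσ (d + 1))) := by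
    refine (integrable_action hf).sub ?_
    have := IsFiniteMeasure.toSigmaFinite (haarO (d + 1))
    have hmp : MeasurePreserving (Prod.map id (rot R)) ((haarO (d + 1)).prod (sphereσ (d + 1)))
        ((haarO (d + 1)).prod (sphereσ (d + 1))) :=
      (MeasurePreserving.id (haarO (d + 1))).prod (measurePreserving_rot R)
    exact hmp.integrable_comp_of_integrable (integrable_action hf)
  have key := integral_abs_zonal_le (k + 2) (P.arc 0) ha (inv_nonneg.mpr hM.le)
  have hker := integrable_zonalKernel (k + 2) (P.arc 0 : Eu (d + 1))
  have hL : avgDiff (fun x => moll f k x) (P.arc 0) (P.arc θ) =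
      ∫ g, |(zonalMass d (k + 2))⁻¹ * ∫ y : USphere (d + 1),
        (1 + ⟪(y : Eu (d + 1)), (P.arc 0 : Eu (d + 1))⟫) ^ (k + 2) *
          (f (rot g y) - f (rot g (rot R y))) ∂(sphereσ (d + 1))| ∂(haarO (d + 1)) := by
    rw [avgDiff]
    congr 1
    ext1 g
    rw [← hR0, ← rot_mul, moll_rot, moll_rot, ← mul_sub, ← integral_sub]
    · simp only [rot_mul, mul_sub]
    · exact integrable_zonal (k + 2) ((measurePreserving_rot g).integrable_comp_of_integrable hf)
        (P.arc 0 : Eu (d + 1))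
    · exact integrable_zonal (k + 2)
        ((measurePreserving_rot (g * R)).integrable_comp_of_integrable hf) (P.arc 0 : Eu (d + 1))
  rw [hL]
  refine key.trans ?_
  calc _ ≤ (zonalMass d (k + 2))⁻¹ * ∫ y : USphere (d + 1),
        (1 + ⟪(y : Eu (d + 1)), (P.arc 0 : Eu (d + 1))⟫) ^ (k + 2) * (S * θ)
          ∂(sphereσ (d + 1)) := by
        refine mul_le_mul_of_nonneg_left ?_ (inv_nonneg.mpr hM.le)
        refine integral_mono_of_nonneg (ae_of_all _ fun y => ?_) (hker.mul_const _)
          (ae_of_all _ fun y => ?_)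
        · exact mul_nonneg (pow_nonneg (one_add_inner_nonneg _ _) _)
            (integral_nonneg fun _ => abs_nonneg _)
        · exact mul_le_mul_of_nonneg_left (hRy y) (pow_nonneg (one_add_inner_nonneg _ _) _)
    _ = S * θ := by
        rw [integral_mul_const, zonalMass_eq]
        field_simp

/-! ### Convergence of the mollifications -/

theorem continuous_avgDiff {h : USphere (d + 1) → ℝ} (hh : Continuous h) (p : USphere (d + 1)) :
    Continuous fun y => avgDiff h y p := by
  have hc : Continuous fun q : USphere (d + 1) × OGroup (d + 1) =>
      |h (rot q.2 q.1) - h (rot q.2 p)| := by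
    refine ((hh.comp (continuous_rot.comp continuous_swap)).sub ?_).abs
    exact hh.comp (continuous_rot.comp (continuous_snd.prodMk continuous_const))
  obtain ⟨C, hC⟩ := isCompact_univ.exists_bound_of_continuousOn hc.continuousOn
  refine continuous_of_dominated (bound := fun _ => C) (fun y => ?_) (fun y => ?_)
    (integrable_const C) ?_
  · exact (hc.comp (continuous_const.prodMk continuous_id)).aestronglyMeasurable
  · exact ae_of_all _ fun g => hC (y, g) (mem_univ _)
  · exact ae_of_all _ fun g => hc.comp (continuous_id.prodMk continuous_const)

/-- Continuity of translation in `L¹`, by approximating `f` with a continuous function. -/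
theorem continuousAt_avgDiff (hf : Integrable f (sphereσ (d + 1))) (p : USphere (d + 1)) :
    ContinuousAt (fun y => avgDiff f y p) p := by
  rw [Metric.continuousAt_iff']
  intro ε hε
  obtain ⟨h, -, hle, hh, hhi⟩ := hf.exists_hasCompactSupport_integral_sub_le
    (ε := ε / 4) (by positivity)
  have h1 := Metric.continuousAt_iff'.mp ((continuous_avgDiff hh p).continuousAt (x := p))
    (ε / 4) (by positivity)
  filter_upwards [h1] with y hy
  rw [avgDiff_self, dist_zero_right, Real.norm_of_nonneg (avgDiff_nonneg _ _)] at hy ⊢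
  have h2 := avgDiff_le_add hf hhi y p
  simp only [Real.norm_eq_abs] at hle
  linarith

/-- The `L¹` error is at most the kernel average of `avgDiff f y p`. The base `1 + ⟪y, p⟫` has its
unique maximum at `y = p`, so its normalized powers concentrate there, where the averaged difference
is continuous and zero. -/
theorem tendsto_integral_moll_sub (hf : Integrable f (sphereσ (d + 1))) :
    Tendsto (fun k => ∫ x : USphere (d + 1), |moll f k x - f x| ∂(sphereσ (d + 1))) atTop
      (𝓝 0) := by
  set p := pole d
  have ha : Integrable (fun q : OGroup (d + 1) × USphere (d + 1) =>
      f (rot q.1 q.2) - f (rot q.1 p)) ((haarO (d + 1)).prod (sphereσ (d + 1))) :=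
    (integrable_action hf).sub ((integrable_orbit hf p).comp_fst _)
  have hg : Integrable (fun y => avgDiff f y p) (sphereσ (d + 1)) := ha.abs.integral_prod_right
  have hpeak := tendsto_setIntegral_pow_smul_of_unique_maximum_of_isCompact_of_integrableOn
    (μ := sphereσ (d + 1)) (s := univ) (x₀ := p) (g := fun y => avgDiff f y p)
    (c := fun y : USphere (d + 1) => 1 + ⟪(y : Eu (d + 1)), (p : Eu (d + 1))⟫) isCompact_univ
    (by fun_prop) ?_ (fun y _ => one_add_inner_nonneg y p)
    (by rw [inner_self_sphere]; norm_num) (by simp) hg.integrableOn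
    (continuousAt_avgDiff hf p).continuousWithinAt
  · simp only [setIntegral_univ, avgDiff_self] at hpeak
    have hpeak2 := hpeak.comp (tendsto_add_atTop_nat 2)
    refine squeeze_zero (fun k => integral_nonneg fun _ => abs_nonneg _) (fun k => ?_) hpeak2
    have hM := zonalMass_pos d (k + 2)
    have hms : AEStronglyMeasurable (fun x : USphere (d + 1) => |moll f k x - f x|)
        (sphereσ (d + 1)) :=
      ((integrable_of_continuous (continuous_moll hf k)).sub hf).abs.aestronglyMeasurable
    rw [← integral_orbit hms p]
    have key := integral_abs_zonal_le (k + 2) p ha (inv_nonneg.mpr hM.le)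
    simp only [Function.comp_apply, smul_eq_mul]
    rw [zonalMass_eq]
    refine le_trans (le_of_eq ?_) key
    congr 1
    ext1 g
    rw [moll_rot]
    simp only [mul_sub]
    rw [integral_sub, integral_mul_const, zonalMass_eq]
    · congr 1
      field_simp
    · exact integrable_zonal (k + 2) ((measurePreserving_rot g).integrable_comp_of_integrable hf)
        (p : Eu (d + 1))
    · exact (integrable_zonalKernel (k + 2) (p : Eu (d + 1))).mul_const _
  · intro y _ hy
    rw [inner_self_sphere]
    have : ⟪(y : Eu (d + 1)), (p : Eu (d + 1))⟫ < 1 := by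
      refine (inner_lt_one_iff_real_of_norm_eq_one (by simp) (by simp)).mpr ?_
      exact fun h => hy (Subtype.ext h)
    linarith

end Asymptotics

/-! ### Averaged differences of functions of bounded variation -/

section BV

variable {d : ℕ} {f : USphere (d + 1) → ℝ}

theorem avgDiff_arc_le (hd : 1 ≤ d) (e : USphere d) (P : OrthoPair (d + 1)) (hf : IsBV f) {θ : ℝ}
    (hθ : 0 ≤ θ) :
    avgDiff f (P.arc 0) (P.arc θ) ≤ θ * (davilaConst e * (totalVariation f).toReal) := by
  rcases hθ.eq_or_lt with rfl | hθ
  · simp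
  have h := (tendsto_integral_moll_sub hf.integrable).const_mul 2
  have h' := h.const_add (θ * (davilaConst e * (totalVariation f).toReal))
  rw [mul_zero, add_zero] at h'
  refine ge_of_tendsto' h' fun k => ?_
  have h1 := avgDiff_le_add hf.integrable
    (integrable_of_continuous (continuous_moll hf.integrable k)) (P.arc 0) (P.arc θ)
  have h2 := avgDiff_moll_le hd e P hf.integrable k hθ
  have h3 : mollVar f k ≤ (totalVariation f).toReal := integral_norm_mollGrad_le hd hf k
  have h4 : θ * (davilaConst e * mollVar f k) ≤
      θ * (davilaConst e * (totalVariation f).toReal) :=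
    mul_le_mul_of_nonneg_left (mul_le_mul_of_nonneg_left h3 (davilaConst_nonneg e)) hθ.le
  simp only [abs_sub_comm (f _)] at h1
  linarith

theorem continuous_sphereDiv {n : ℕ} {X : Eu n → Eu n} (hX : ContDiff ℝ 1 X) :
    Continuous fun x : USphere n => sphereDiv X x := by
  have hD : Continuous fun x : USphere n => fderiv ℝ X x :=
    (hX.continuous_fderiv one_ne_zero).comp continuous_subtype_val
  unfold sphereDiv
  simp only [LinearMap.trace_eq_sum_inner _ (EuclideanSpace.basisFun (Fin n) ℝ),
    ContinuousLinearMap.coe_coe]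
  refine Continuous.sub ?_ ?_
  · exact continuous_finsetSum _ fun i _ =>
      continuous_const.inner (hD.clm_apply continuous_const)
  · exact (hD.clm_apply continuous_subtype_val).inner continuous_subtype_val

/-- Integration by parts: the divergence theorem is applied to the product of the mollification and
`X`. -/
theorem integral_moll_mul_sphereDiv_le (hf : Integrable f (sphereσ (d + 1))) (k : ℕ)
    {X : Eu (d + 1) → Eu (d + 1)} (hX : IsTestField X) :
    ∫ x : USphere (d + 1), moll f k x * sphereDiv X x ∂(sphereσ (d + 1)) ≤ mollVar f k := by
  have hX1 : ContDiff ℝ 1 X := hX.smooth.of_le (by simp)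
  have hm1 : ContDiff ℝ 1 (moll f k) := (contDiff_moll hf k).of_le (by simp)
  have hdiv : ∀ x : USphere (d + 1), sphereDiv (fun z => moll f k z • X z) x =
      moll f k x * sphereDiv X x +
        ⟪tangentPart (x : Eu (d + 1)) (mollGrad f k x), X x⟫ := by
    intro x
    have h : HasFDerivAt (fun z => moll f k z • X z) _ (x : Eu (d + 1)) :=
      (hasFDerivAt_moll hf k (x : Eu (d + 1))).smul
        (hX1.differentiable one_ne_zero (x : Eu (d + 1))).hasFDerivAt
    rw [sphereDiv_eq, h.fderiv, map_add, map_smul, tangentTrace_smulRight, hX.tangent x, mul_zero,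
      sub_zero, smul_eq_mul, ← sphereDiv_eq, innerSL_apply_apply,
      inner_tangentPart_of_tangent _ _ _ (hX.tangent x)]
  have h0 := integral_sphereDiv_eq_zero (Y := fun z => moll f k z • X z) (hm1.smul hX1)
    fun x => by rw [inner_smul_left, hX.tangent x, mul_zero]
  simp only [hdiv] at h0
  have hXc : Continuous fun x : USphere (d + 1) => X x :=
    hX1.continuous.comp continuous_subtype_val
  have hw := continuous_tangentPart_mollGrad hf k
  have i1 : Integrable (fun x : USphere (d + 1) => moll f k x * sphereDiv X x)
      (sphereσ (d + 1)) :=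
    integrable_of_continuous ((continuous_moll hf k).mul (continuous_sphereDiv hX1))
  have i2 : Integrable (fun x : USphere (d + 1) =>
      ⟪tangentPart (x : Eu (d + 1)) (mollGrad f k x), X x⟫) (sphereσ (d + 1)) :=
    integrable_of_continuous (hw.inner hXc)
  rw [integral_add i1 i2] at h0
  rw [eq_neg_of_add_eq_zero_left h0, ← integral_neg, mollVar]
  refine integral_mono i2.neg (integrable_of_continuous hw.norm) fun x => ?_
  refine (neg_le_abs _).trans ((abs_real_inner_le_norm _ _).trans ?_)
  exact mul_le_of_le_one_right (norm_nonneg _) (hX.norm_le_one x)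

/-- A bound on the averaged difference quotients bounds the total variation. -/
theorem davilaConst_mul_variation_le (hd : 1 ≤ d) (e : USphere d) (P : OrthoPair (d + 1))
    (hf : Integrable f (sphereσ (d + 1))) {S : ℝ}
    (hS : ∀ t, 0 < t → t ≤ Real.pi → avgDiff f (P.arc 0) (P.arc t) ≤ S * t) :
    davilaConst e * (totalVariation f).toReal ≤ S := by
  have hS0 : 0 ≤ S := by
    have := (avgDiff_nonneg _ _).trans (hS Real.pi Real.pi_pos le_rfl)
    exact nonneg_of_mul_nonneg_left this Real.pi_pos
  have hvar : ∀ k, davilaConst e * mollVar f k ≤ S := by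
    intro k
    refine le_of_tendsto (tendsto_avgDiff_moll hd e P hf k) ?_
    filter_upwards [Ioo_mem_nhdsGT Real.pi_pos] with t ht
    rw [div_le_iff₀ ht.1]
    exact avgDiff_moll_le_of_le P hf k hS ht.1.le ht.2.le
  -- As `0 ≤ S`, the case of a zero constant is immediate, so its positivity need not be proved.
  rcases (davilaConst_nonneg e).eq_or_lt with hK | hK
  · rw [← hK, zero_mul]
    exact hS0
  rw [mul_comm, ← le_div_iff₀ hK]
  refine ENNReal.toReal_le_of_le_ofReal (div_nonneg hS0 hK.le) (iSup₂_le fun X hX => ?_)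
  refine ENNReal.ofReal_le_ofReal ?_
  have hX1 : ContDiff ℝ 1 X := hX.smooth.of_le (by simp)
  have hc := continuous_sphereDiv hX1
  obtain ⟨C, hC⟩ := isCompact_univ.exists_bound_of_continuousOn hc.continuousOn
  have hlim : Tendsto (fun k => ∫ x : USphere (d + 1), moll f k x * sphereDiv X x
      ∂(sphereσ (d + 1))) atTop (𝓝 (∫ x, f x * sphereDiv X x ∂(sphereσ (d + 1)))) := by
    rw [tendsto_iff_norm_sub_tendsto_zero]
    have h0 := (tendsto_integral_moll_sub hf).mul_const C
    rw [zero_mul] at h0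
    refine squeeze_zero (fun k => norm_nonneg _) (fun k => ?_) h0
    have hm := integrable_of_continuous (continuous_moll hf k)
    have i1 : Integrable (fun x : USphere (d + 1) => moll f k x * sphereDiv X x)
        (sphereσ (d + 1)) := integrable_of_continuous ((continuous_moll hf k).mul hc)
    have i2 : Integrable (fun x : USphere (d + 1) => f x * sphereDiv X x) (sphereσ (d + 1)) :=
      hf.mul_bdd (c := C) hc.aestronglyMeasurable (ae_of_all _ fun x => hC x (mem_univ x))
    rw [← integral_sub i1 i2, ← integral_mul_const]
    refine norm_integral_le_of_norm_le ((hm.sub hf).abs.mul_const C) (ae_of_all _ fun x => ?_)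
    rw [← sub_mul, norm_mul]
    exact mul_le_mul_of_nonneg_left (hC x (mem_univ x)) (abs_nonneg _)
  refine le_of_tendsto' hlim fun k => ?_
  rw [le_div_iff₀ hK, mul_comm]
  exact (mul_le_mul_of_nonneg_left (integral_moll_mul_sphereDiv_le hf k hX) hK.le).trans (hvar k)

/-- The averaged difference quotients are almost maximal for small angles. -/
theorem eventually_le_avgDiff_arc (hd : 1 ≤ d) (e : USphere d) (P : OrthoPair (d + 1))
    (hf : IsBV f) {ε : ℝ} (hε : 0 < ε) :
    ∃ δ : ℝ, 0 < δ ∧ ∀ θ, 0 < θ → θ < δ →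
      θ * (davilaConst e * (totalVariation f).toReal - ε) ≤ avgDiff f (P.arc 0) (P.arc θ) := by
  set V := davilaConst e * (totalVariation f).toReal with hV
  have hV0 : 0 ≤ V := mul_nonneg (davilaConst_nonneg e) ENNReal.toReal_nonneg
  obtain ⟨t, ht, -, hlt⟩ : ∃ t, 0 < t ∧ t ≤ Real.pi ∧
      (V - ε / 2) * t < avgDiff f (P.arc 0) (P.arc t) := by
    by_contra! hcon
    have := davilaConst_mul_variation_le hd e P hf.integrable hcon
    linarith
  -- At the angle `t` the quotient is within `ε / 2` of `V`. Write `t` as `j` steps of length `θ`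
  -- plus a remainder at most `θ`, which costs at most `θ * V`; the choice of `δ` makes this at most
  -- `ε * t / 2`. The `+ 1` allows `V = 0`.
  refine ⟨ε * t / (2 * (V + 1)), by positivity, fun θ hθ hθδ => ?_⟩
  rw [lt_div_iff₀ (by positivity)] at hθδ
  set j := ⌊t / θ⌋₊
  have hj : (j : ℝ) * θ ≤ t := by
    rw [← le_div_iff₀ hθ]
    exact Nat.floor_le (by positivity)
  have hj2 : t - j * θ ≤ θ := by
    have := (Nat.lt_floor_add_one (t / θ)).le
    rw [div_le_iff₀ hθ] at this
    linarith
  set A := avgDiff f (P.arc 0) (P.arc θ)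
  have hA : 0 ≤ A := avgDiff_nonneg _ _
  have h1 := avgDiff_arc_add hf.integrable P (j * θ) (t - j * θ)
  rw [add_sub_cancel] at h1
  have h2 := avgDiff_arc_nat_mul hf.integrable P θ j
  have h3 := avgDiff_arc_le hd e P hf (sub_nonneg.mpr hj)
  have h4 : (t - j * θ) * V ≤ θ * V := mul_le_mul_of_nonneg_right hj2 hV0
  have h5 : (V - ε / 2) * t < j * A + θ * V := by linarith
  have h6 : θ * (j * A) ≤ t * A := by
    calc θ * (j * A) = (j * θ) * A := by ring
      _ ≤ t * A := mul_le_mul_of_nonneg_right hj hA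
  have h7 : θ * V ≤ ε * t / 2 := by nlinarith
  have h8 : θ * ((V - ε / 2) * t) ≤ θ * (j * A + θ * V) := mul_le_mul_of_nonneg_left h5.le hθ.le
  have h9 : θ * (θ * V) ≤ θ * (ε * t / 2) := mul_le_mul_of_nonneg_left h7 hθ.le
  have h10 : t * (θ * (V - ε)) ≤ t * A := by nlinarith
  exact le_of_mul_le_mul_left h10 ht

end BV

/-! ### Radial mollifiers -/

section Main

variable {d : ℕ} {f : USphere (d + 1) → ℝ}

theorem geoDist_nonneg {n : ℕ} (x y : USphere n) : 0 ≤ geoDist x y := Real.arccos_nonneg _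

theorem geoDist_comm {n : ℕ} (x y : USphere n) : geoDist x y = geoDist y x := by
  rw [geoDist, geoDist, real_inner_comm]

theorem geoDist_eq_zero {n : ℕ} {x y : USphere n} (h : geoDist x y = 0) : x = y := by
  have h1 := cos_geoDist x y
  rw [h, Real.cos_zero] at h1
  exact Subtype.ext ((inner_eq_one_iff_of_norm_eq_one (𝕜 := ℝ) (by simp) (by simp)).mp h1.symm)

theorem measurable_geoDist_right {n : ℕ} (p : USphere n) : Measurable fun y => geoDist p y := by
  unfold geoDist
  exact Real.measurable_arccos.comp (by fun_prop)

theorem measurable_indicator_Ioi {ρ : ℝ → ℝ} (hρ : Measurable fun r : Ioi (0 : ℝ) => ρ r) :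
    Measurable ((Ioi (0 : ℝ)).indicator ρ) := by
  refine measurable_of_restrict_of_restrict_compl (measurableSet_Ioi (a := (0 : ℝ))) ?_ ?_
  · convert hρ using 1
    ext r
    exact indicator_of_mem r.2 ρ
  · convert measurable_const (a := (0 : ℝ)) using 1
    ext r
    exact indicator_of_notMem r.2 ρ

/-- The double integral against a radial kernel, through averaged differences. -/
theorem integral_radial_eq (P : OrthoPair (d + 1)) (hfm : Measurable f)
    (hf : Integrable f (sphereσ (d + 1))) {φ : ℝ → ℝ} (hφ : Measurable φ) (hφ0 : ∀ r, 0 ≤ φ r)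
    (hint : Integrable (fun y => avgDiff f (P.arc 0) y / geoDist (P.arc 0) y *
      φ (geoDist (P.arc 0) y)) (sphereσ (d + 1))) :
    Integrable (fun p : USphere (d + 1) × USphere (d + 1) =>
        |f p.1 - f p.2| / geoDist p.1 p.2 * φ (geoDist p.1 p.2))
      ((sphereσ (d + 1)).prod (sphereσ (d + 1))) ∧
    ∫ p : USphere (d + 1) × USphere (d + 1),
        |f p.1 - f p.2| / geoDist p.1 p.2 * φ (geoDist p.1 p.2)
          ∂((sphereσ (d + 1)).prod (sphereσ (d + 1))) =
      ∫ y, avgDiff f (P.arc 0) y / geoDist (P.arc 0) y *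
        φ (geoDist (P.arc 0) y) ∂(sphereσ (d + 1)) := by
  set H : USphere (d + 1) × USphere (d + 1) → ℝ := fun p =>
    |f p.1 - f p.2| / geoDist p.1 p.2 * φ (geoDist p.1 p.2) with hH
  have hHm : Measurable H := by
    refine Measurable.mul (Measurable.div ?_ measurable_geoDist) (hφ.comp measurable_geoDist)
    exact ((hfm.comp measurable_fst).sub (hfm.comp measurable_snd)).abs
  have hH0 : ∀ p, 0 ≤ H p := fun p =>
    mul_nonneg (div_nonneg (abs_nonneg _) (geoDist_nonneg _ _)) (hφ0 _)
  have hB0 : ∀ y, 0 ≤ avgDiff f (P.arc 0) y / geoDist (P.arc 0) y *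
      φ (geoDist (P.arc 0) y) := fun y =>
    mul_nonneg (div_nonneg (avgDiff_nonneg _ _) (geoDist_nonneg _ _)) (hφ0 _)
  -- Pairs are parametrized as `(g p, g y)`, with `p` the base point `P.arc 0`. The radial factors
  -- are invariant, so only `|f (g p) - f (g y)|` is averaged.
  have key : ∫⁻ p, ENNReal.ofReal (H p) ∂((sphereσ (d + 1)).prod (sphereσ (d + 1))) =
      ∫⁻ y, ENNReal.ofReal (avgDiff f (P.arc 0) y / geoDist (P.arc 0) y *
        φ (geoDist (P.arc 0) y)) ∂(sphereσ (d + 1)) := by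
    rw [lintegral_prod_sphere_eq (P.arc 0) hHm.ennreal_ofReal]
    congr 1
    ext1 y
    simp only [hH, geoDist_rot]
    rw [← ofReal_integral_eq_lintegral_ofReal, integral_mul_const, integral_div]
    · rfl
    · exact ((integrable_orbit_sub hf _ _).div_const _).mul_const _
    · exact ae_of_all _ fun g =>
        mul_nonneg (div_nonneg (abs_nonneg _) (geoDist_nonneg _ _)) (hφ0 _)
  have hHi : Integrable H ((sphereσ (d + 1)).prod (sphereσ (d + 1))) := by
    refine (lintegral_ofReal_ne_top_iff_integrable hHm.aestronglyMeasurable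
      (ae_of_all _ hH0)).mp ?_
    rw [key]
    exact (lintegral_ofReal_ne_top_iff_integrable hint.aestronglyMeasurable
      (ae_of_all _ hB0)).mpr hint
  refine ⟨hHi, ?_⟩
  rw [integral_eq_lintegral_of_nonneg_ae (ae_of_all _ hH0) hHm.aestronglyMeasurable, key,
    integral_eq_lintegral_of_nonneg_ae (ae_of_all _ hB0) hint.aestronglyMeasurable]

theorem integrable_avgDiff (hf : Integrable f (sphereσ (d + 1))) (p : USphere (d + 1)) :
    Integrable (fun y => avgDiff f p y) (sphereσ (d + 1)) := by
  have ha : Integrable (fun q : OGroup (d + 1) × USphere (d + 1) =>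
      f (rot q.1 p) - f (rot q.1 q.2)) ((haarO (d + 1)).prod (sphereσ (d + 1))) :=
    ((integrable_orbit hf p).comp_fst _).sub (integrable_action hf)
  exact ha.abs.integral_prod_right

/-- After reduction to one variable, the integrand is at most `V` times the mollifier everywhere and
at least `V - ε` times it near the base point, where the mass concentrates. -/
theorem tendsto_radial_of_measurable (hd : 1 ≤ d) (e : USphere d) (hfm : Measurable f)
    (hf : IsBV f) {ι : Type*} (l : Filter ι) (ρ : ι → ℝ → ℝ)
    (hρ : IsRadialMollifier (d + 1) l ρ) :
    (∀ L, Integrable (fun p : USphere (d + 1) × USphere (d + 1) =>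
        |f p.1 - f p.2| / geoDist p.1 p.2 * ρ L (geoDist p.1 p.2))
      ((sphereσ (d + 1)).prod (sphereσ (d + 1)))) ∧
    Tendsto (fun L => ∫ p : USphere (d + 1) × USphere (d + 1),
        |f p.1 - f p.2| / geoDist p.1 p.2 * ρ L (geoDist p.1 p.2)
          ∂((sphereσ (d + 1)).prod (sphereσ (d + 1))))
      l (𝓝 (davilaConst e * (totalVariation f).toReal)) := by
  obtain ⟨P⟩ := exists_orthoPair hd
  set p := P.arc 0 with hp
  set V := davilaConst e * (totalVariation f).toReal with hV
  have hV0 : 0 ≤ V := mul_nonneg (davilaConst_nonneg e) ENNReal.toReal_nonneg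
  set φ : ι → ℝ → ℝ := fun L => (Ioi (0 : ℝ)).indicator (ρ L) with hφdef
  have hφm : ∀ L, Measurable (φ L) := fun L => measurable_indicator_Ioi (hρ.measurable L)
  have hφ0 : ∀ L r, 0 ≤ φ L r := fun L r => indicator_nonneg (fun s hs => hρ.nonneg L s hs) r
  have hφpos : ∀ L r, 0 < r → φ L r = ρ L r := fun L r hr => indicator_of_mem (mem_Ioi.mpr hr) _
  have hφzero : ∀ L, φ L 0 = 0 := fun L => indicator_of_notMem (by simp) _
  -- On the diagonal both sides vanish, since division by zero gives zero; extending `ρ L` by `0`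
  -- outside `(0, ∞)` changes nothing.
  have hint_eq : ∀ L, (fun q : USphere (d + 1) × USphere (d + 1) =>
      |f q.1 - f q.2| / geoDist q.1 q.2 * ρ L (geoDist q.1 q.2)) = fun q =>
      |f q.1 - f q.2| / geoDist q.1 q.2 * φ L (geoDist q.1 q.2) := by
    intro L
    ext1 q
    rcases (geoDist_nonneg q.1 q.2).eq_or_lt with h | h
    · simp [← h]
    · rw [hφpos L _ h]
  have hmass_ae : ∀ L, (fun y => φ L (geoDist p y)) =ᵐ[sphereσ (d + 1)]
      fun y => ρ L (geoDist y p) := by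
    intro L
    have : ∀ᵐ y ∂(sphereσ (d + 1)), y ≠ p := by
      rw [ae_iff]
      simpa using sphereσ_singleton hd p
    filter_upwards [this] with y hy
    rw [geoDist_comm y p]
    refine hφpos L _ ((geoDist_nonneg p y).lt_of_ne fun h => hy ?_)
    exact (geoDist_eq_zero h.symm).symm
  have hmass : ∀ L, ∫ y, φ L (geoDist p y) ∂(sphereσ (d + 1)) = 1 := fun L => by
    rw [integral_congr_ae (hmass_ae L), hρ.mass_one L p]
  -- A function that is not integrable would have integral `0`, not `1`.
  have hφi : ∀ L, Integrable (fun y => φ L (geoDist p y)) (sphereσ (d + 1)) := fun L =>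
    Integrable.of_integral_ne_zero (by rw [hmass L]; exact one_ne_zero)
  set B : ι → USphere (d + 1) → ℝ := fun L y => avgDiff f p y / geoDist p y * φ L (geoDist p y)
    with hB
  have hB0 : ∀ L y, 0 ≤ B L y := fun L y =>
    mul_nonneg (div_nonneg (avgDiff_nonneg _ _) (geoDist_nonneg _ _)) (hφ0 _ _)
  have hBle : ∀ L y, B L y ≤ V * φ L (geoDist p y) := by
    intro L y
    refine mul_le_mul_of_nonneg_right ?_ (hφ0 _ _)
    refine div_le_of_le_mul₀ (geoDist_nonneg _ _) hV0 ?_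
    rw [avgDiff_eq_arc P, mul_comm]
    exact avgDiff_arc_le hd e P hf (geoDist_nonneg _ _)
  have hBm : ∀ L, AEStronglyMeasurable (B L) (sphereσ (d + 1)) := fun L =>
    (((integrable_avgDiff hf.integrable p).aestronglyMeasurable.aemeasurable.div
      (measurable_geoDist_right p).aemeasurable).mul
      ((hφm L).comp (measurable_geoDist_right p)).aemeasurable).aestronglyMeasurable
  have hBi : ∀ L, Integrable (B L) (sphereσ (d + 1)) := fun L =>
    ((hφi L).const_mul V).mono' (hBm L) (ae_of_all _ fun y => by
      rw [Real.norm_of_nonneg (hB0 L y)]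
      exact hBle L y)
  have hmain := fun L => integral_radial_eq P hfm hf.integrable (hφm L) (hφ0 L) (hBi L)
  simp only [hint_eq]
  refine ⟨fun L => (hmain L).1, ?_⟩
  simp only [fun L => (hmain L).2]
  have hupper : ∀ L, ∫ y, B L y ∂(sphereσ (d + 1)) ≤ V := fun L => by
    have := integral_mono (hBi L) ((hφi L).const_mul V) (hBle L)
    rwa [integral_const_mul, hmass, mul_one] at this
  refine tendsto_order.mpr ⟨fun a ha => ?_, fun b hb =>
    Eventually.of_forall fun L => (hupper L).trans_lt hb⟩
  obtain ⟨δ, hδ, hlow⟩ := eventually_le_avgDiff_arc hd e P hf (half_pos (sub_pos.mpr ha))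
  rw [← hV] at hlow
  set ε := (V - a) / 2 with hε
  have hs : MeasurableSet {y : USphere (d + 1) | geoDist p y < δ} :=
    measurable_geoDist_right p measurableSet_Iio
  have hconc : Tendsto (fun L => ∫ y in {y : USphere (d + 1) | geoDist p y < δ}ᶜ,
      φ L (geoDist p y) ∂(sphereσ (d + 1))) l (𝓝 0) := by
    refine (hρ.concentrate p δ hδ).congr fun L => ?_
    have hset : {y : USphere (d + 1) | geoDist y p < δ} = {y | geoDist p y < δ} := by
      ext y
      simp only [mem_ofPred_eq, geoDist_comm y p]
    rw [hset]
    exact (integral_congr_ae (ae_restrict_of_ae (hmass_ae L))).symm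
  have hlower : ∀ L, (V - ε) * (1 - ∫ y in {y : USphere (d + 1) | geoDist p y < δ}ᶜ,
      φ L (geoDist p y) ∂(sphereσ (d + 1))) ≤ ∫ y, B L y ∂(sphereσ (d + 1)) := by
    intro L
    have hsplit := integral_add_compl hs (hφi L)
    rw [hmass] at hsplit
    rw [← eq_sub_of_add_eq hsplit, ← integral_const_mul]
    refine (setIntegral_mono_on ((hφi L).const_mul _).integrableOn (hBi L).integrableOn hs
      fun y hy => ?_).trans (setIntegral_le_integral (hBi L) (ae_of_all _ (hB0 L)))
    rcases (geoDist_nonneg p y).eq_or_lt with h | h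
    · simp [hB, ← h, hφzero]
    · refine mul_le_mul_of_nonneg_right ?_ (hφ0 _ _)
      rw [le_div_iff₀ h, avgDiff_eq_arc P, mul_comm]
      exact hlow _ h hy
  have hlim : Tendsto (fun L => (V - ε) * (1 - ∫ y in {y : USphere (d + 1) | geoDist p y < δ}ᶜ,
      φ L (geoDist p y) ∂(sphereσ (d + 1)))) l (𝓝 (V - ε)) := by
    simpa using (hconc.const_sub 1).const_mul (V - ε)
  have haε : a < V - ε := by rw [hε]; linarith
  filter_upwards [hlim.eventually (lt_mem_nhds haε)] with L hL
  exact hL.trans_le (hlower L)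

theorem totalVariation_congr {n : ℕ} {f f' : USphere n → ℝ} (h : f =ᵐ[sphereσ n] f') :
    totalVariation f = totalVariation f' := by
  unfold totalVariation
  congr 1
  ext1 X
  congr 1
  ext1 _
  congr 1
  refine integral_congr_ae ?_
  filter_upwards [h] with x hx
  rw [hx]

end Main

end

theorem mainTheorem1 (d : ℕ) (hd : 1 ≤ d) (e : USphere d)
    (f : USphere (d + 1) → ℝ) (hf : IsBV f)
    {ι : Type*} (l : Filter ι) (ρ : ι → ℝ → ℝ) (hρ : IsRadialMollifier (d + 1) l ρ) :
    (∀ L, Integrable (fun p : USphere (d + 1) × USphere (d + 1) =>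
        |f p.1 - f p.2| / geoDist p.1 p.2 * ρ L (geoDist p.1 p.2))
      ((sphereσ (d + 1)).prod (sphereσ (d + 1)))) ∧
    Tendsto (fun L => ∫ p : USphere (d + 1) × USphere (d + 1),
        |f p.1 - f p.2| / geoDist p.1 p.2 * ρ L (geoDist p.1 p.2)
          ∂((sphereσ (d + 1)).prod (sphereσ (d + 1))))
      l (𝓝 (davilaConst e * (totalVariation f).toReal)) := by
  -- A Borel representative is used because the change of variables over the orthogonal group is
  -- proved for measurable integrands; neither the variation nor the double integral sees the
  -- difference.
  have hae : f =ᵐ[sphereσ (d + 1)] hf.integrable.aestronglyMeasurable.mk f :=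
    hf.integrable.aestronglyMeasurable.ae_eq_mk
  set f' := hf.integrable.aestronglyMeasurable.mk f
  have hf'm : Measurable f' := hf.integrable.aestronglyMeasurable.stronglyMeasurable_mk.measurable
  have hTV := totalVariation_congr hae
  have hf' : IsBV f' := ⟨hf.integrable.congr hae, hTV ▸ hf.finite_variation⟩
  have hcongr : ∀ L, (fun p : USphere (d + 1) × USphere (d + 1) =>
        |f p.1 - f p.2| / geoDist p.1 p.2 * ρ L (geoDist p.1 p.2)) =ᵐ[
      (sphereσ (d + 1)).prod (sphereσ (d + 1))] fun p =>
        |f' p.1 - f' p.2| / geoDist p.1 p.2 * ρ L (geoDist p.1 p.2) := by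
    intro L
    filter_upwards [Measure.quasiMeasurePreserving_fst.ae_eq_comp hae,
      Measure.quasiMeasurePreserving_snd.ae_eq_comp hae] with p h1 h2
    simp only [Function.comp_apply] at h1 h2
    rw [h1, h2]
  obtain ⟨hI, hT⟩ := tendsto_radial_of_measurable hd e hf'm hf' l ρ hρ
  refine ⟨fun L => (hI L).congr (hcongr L).symm, ?_⟩
  rw [hTV]
  exact hT.congr fun L => (integral_congr_ae (hcongr L)).symm
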